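/- Let $\mathbb{D}$ be the open unit disc, $dm$ the normalised Lebesgue measure on the unit circle $\partial\mathbb{D}$ and $dA$ the area measure on $\mathbb{C}$. The little Bloch space $\mathcal{B}_0$ is the space of holomorphic functions $f$ on $\mathbb{D}$ with $\lim_{|z|\to 1-}(1-|z|)f'(z)=0$, equipped with the norm $\|f\|_{\mathcal{B}}=|f(0)|+\sup_{z\in\mathbb{D}}(1-|z|)|f'(z)|$. A measurable set $E\subseteq\partial\mathbb{D}$ has the SA-property (simultaneous approximation) with respect to $\mathcal{B}_0$ if the set $\{(Q,Q|_E): Q \text{ an analytic polynomial}\}$ is dense in $\mathcal{B}_0\oplus L^\infty(E)$, where $\mathcal{B}_0$ carries its norm topology and $L^\infty(E)=L^\infty(E,dm)$ the weak-star topology, that is, the coarsest topology for which $g\mapsto\int_E g\,h\,dm$ is continuous for every $h\in L^1(E)$. A compact set $K\subset\mathbb{C}$ is removable for the analytic Sobolev space $W^1_a$ if every holomorphic function $F$ on $\mathbb{C}\setminus K$ with $\int_{\mathbb{C}\setminus K}|F'|\,dA<\infty$ is constant. **Corollary 2.5.** If a compact set $K\subseteq\partial\mathbb{D}$ of positive Lebesgue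 measure has the SA-property with respect to $\mathcal{B}_0$, then $K$ is removable for $W^1_a$. -/

import Mathlib

open Set Filter Topology MeasureTheory
open scoped ENNReal

noncomputable section

namespace BlochSA

/-- The open unit disc. -/
abbrev disc : Set ℂ := Metric.ball 0 1

/-- The unit circle, as a subset of the plane. -/
abbrev unitCircle : Set ℂ := Metric.sphere 0 1

/-- Normalised Lebesgue (arc length) measure `dm` on the unit circle, as a measure on the plane
that is carried by the circle: the image of `dθ / 2π` on `(0, 2π]` under `θ ↦ exp (i θ)`. -/
def circleMeasure : Measure ℂ :=
  ENNReal.ofReal (2 * Real.pi)⁻¹ •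
    (volume.restrict (Ioc 0 (2 * Real.pi))).map (circleMap 0 1)

instance : IsFiniteMeasure circleMeasure := by
  unfold circleMeasure
  have : IsFiniteMeasure ((volume.restrict (Ioc 0 (2 * Real.pi))).map (circleMap 0 1)) := by
    infer_instance
  exact Measure.smul_finite _ ENNReal.ofReal_ne_top

theorem ae_mem_unitCircle : ∀ᵐ ζ ∂circleMeasure, ζ ∈ unitCircle := by
  refine Measure.ae_smul_measure ?_ _
  refine (ae_map_iff (continuous_circleMap 0 1).aemeasurable
    Metric.isClosed_sphere.measurableSet).2 ?_
  exact Eventually.of_forall fun θ => circleMap_mem_sphere 0 zero_le_one θ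

/-- The vector space of holomorphic functions `f` on the unit disc such that `(1 - |z|) f'(z) → 0` as
`|z| → 1-`. A function on the disc is represented by its extension by zero to the plane. -/
def littleBlochSubmodule : Submodule ℂ (ℂ → ℂ) where
  carrier := {f | DifferentiableOn ℂ f disc ∧ (∀ z, z ∉ disc → f z = 0) ∧
    Tendsto (fun z : ℂ => ((1 - ‖z‖ : ℝ) : ℂ) * deriv f z) (comap norm (𝓝[<] (1 : ℝ))) (𝓝 0)}
  zero_mem' := by
    refine ⟨differentiableOn_const 0, fun _ _ => rfl, ?_⟩
    have : deriv (0 : ℂ → ℂ) = 0 := by ext z; exact deriv_const z 0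
    simp [this, tendsto_const_nhds]
  add_mem' := by
    rintro f g ⟨hf, hf0, hf'⟩ ⟨hg, hg0, hg'⟩
    refine ⟨hf.add hg, fun z hz => by simp [hf0 z hz, hg0 z hz], ?_⟩
    have h := hf'.add hg'
    rw [add_zero] at h
    refine h.congr' ?_
    have hev : ∀ᶠ z : ℂ in comap norm (𝓝[<] (1 : ℝ)), z ∈ disc := by
      filter_upwards [preimage_mem_comap (self_mem_nhdsWithin : Iio (1 : ℝ) ∈ 𝓝[<] (1 : ℝ))]
        with z hz
      simpa using hz
    filter_upwards [hev] with z hz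
    have hz' := Metric.isOpen_ball.mem_nhds hz
    rw [deriv_add (hf.differentiableAt hz') (hg.differentiableAt hz')]
    ring
  smul_mem' := by
    rintro c f ⟨hf, hf0, hf'⟩
    refine ⟨hf.const_smul c, fun z hz => by simp [hf0 z hz], ?_⟩
    have h := hf'.const_mul c
    rw [mul_zero] at h
    refine h.congr fun z => ?_
    rw [deriv_const_smul_field]
    simp only [smul_eq_mul]
    ring

/-- The little Bloch space `ℬ₀`, which carries the Bloch norm (and no other topology). -/
def LittleBloch : Type := littleBlochSubmodule

namespace LittleBloch

instance : AddCommGroup LittleBloch := inferInstanceAs (AddCommGroup littleBlochSubmodule)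

instance : Module ℂ LittleBloch := inferInstanceAs (Module ℂ littleBlochSubmodule)

instance : CoeFun LittleBloch (fun _ => ℂ → ℂ) := ⟨fun f => f.1⟩

theorem coe_add (f g : LittleBloch) : ((f + g : LittleBloch) : ℂ → ℂ) = (f : ℂ → ℂ) + g := rfl

theorem coe_neg (f : LittleBloch) : ((-f : LittleBloch) : ℂ → ℂ) = -(f : ℂ → ℂ) := rfl

theorem coe_zero : ((0 : LittleBloch) : ℂ → ℂ) = 0 := rfl

theorem differentiableAt (f : LittleBloch) {z : ℂ} (hz : z ∈ disc) :
    DifferentiableAt ℂ (f : ℂ → ℂ) z :=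
  f.2.1.differentiableAt (Metric.isOpen_ball.mem_nhds hz)

/-- The quantity `(1 - |z|) |f'(z)|` at a point of the disc. -/
def weightedDeriv (f : LittleBloch) (z : disc) : ℝ :=
  (1 - ‖(z : ℂ)‖) * ‖deriv (f : ℂ → ℂ) z‖

theorem one_sub_norm_pos (z : disc) : 0 < 1 - ‖(z : ℂ)‖ := by
  have := z.2
  rw [mem_ball_zero_iff] at this
  linarith

theorem weightedDeriv_nonneg (f : LittleBloch) (z : disc) : 0 ≤ weightedDeriv f z :=
  mul_nonneg (one_sub_norm_pos z).le (norm_nonneg _)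

theorem bddAbove_weightedDeriv (f : LittleBloch) : BddAbove (range (weightedDeriv f)) := by
  have h1 : ∀ᶠ z : ℂ in comap norm (𝓝[<] (1 : ℝ)),
      ‖((1 - ‖z‖ : ℝ) : ℂ) * deriv (f : ℂ → ℂ) z‖ < 1 := by
    have := f.2.2.2.norm
    rw [norm_zero] at this
    exact this.eventually (gt_mem_nhds one_pos)
  rw [eventually_comap] at h1
  obtain ⟨r, hr, hr1⟩ := (mem_nhdsLT_iff_exists_Ioo_subset).1 h1
  have hsub : Metric.closedBall (0 : ℂ) r ⊆ disc := Metric.closedBall_subset_ball hr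
  have hcont : ContinuousOn (fun z : ℂ => (1 - ‖z‖) * ‖deriv (f : ℂ → ℂ) z‖)
      (Metric.closedBall 0 r) := by
    refine ContinuousOn.mul (by fun_prop) (ContinuousOn.norm ?_)
    exact ((f.2.1.deriv Metric.isOpen_ball).continuousOn).mono hsub
  obtain ⟨C, hC⟩ := (isCompact_closedBall (0 : ℂ) r).exists_bound_of_continuousOn hcont
  refine ⟨max C 1, ?_⟩
  rintro _ ⟨z, rfl⟩
  by_cases hz : ‖(z : ℂ)‖ ≤ r
  · exact (le_abs_self _).trans ((hC z (by simpa using hz)).trans (le_max_left _ _))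
  · have hz1 : ‖(z : ℂ)‖ < 1 := mem_ball_zero_iff.1 z.2
    have := hr1 ⟨not_le.1 hz, hz1⟩ (z : ℂ) rfl
    rw [norm_mul, Complex.norm_real, Real.norm_of_nonneg (one_sub_norm_pos z).le] at this
    exact this.le.trans (le_max_right _ _)

/-- The Bloch norm `|f(0)| + sup_{|z| < 1} (1 - |z|) |f'(z)|`. -/
def blochNorm (f : LittleBloch) : ℝ :=
  ‖(f : ℂ → ℂ) 0‖ + ⨆ z : disc, weightedDeriv f z

instance : Nonempty disc := ⟨⟨0, Metric.mem_ball_self one_pos⟩⟩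

theorem weightedDeriv_add_le (f g : LittleBloch) (z : disc) :
    weightedDeriv (f + g) z ≤ weightedDeriv f z + weightedDeriv g z := by
  unfold weightedDeriv
  rw [coe_add, deriv_add (differentiableAt f z.2) (differentiableAt g z.2), ← mul_add]
  exact mul_le_mul_of_nonneg_left (norm_add_le _ _) (one_sub_norm_pos z).le

instance : NormedAddCommGroup LittleBloch :=
  AddGroupNorm.toNormedAddCommGroup
    { toFun := blochNorm
      map_zero' := by
        have h : ∀ z, weightedDeriv 0 z = 0 := by
          intro z
          have : deriv (0 : ℂ → ℂ) z = 0 := deriv_const (z : ℂ) 0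
          simp [weightedDeriv, coe_zero, this]
        simp [blochNorm, coe_zero, h]
      add_le' := by
        intro f g
        have h : (⨆ z : disc, weightedDeriv (f + g) z) ≤
            (⨆ z : disc, weightedDeriv f z) + ⨆ z : disc, weightedDeriv g z :=
          ciSup_le fun z => (weightedDeriv_add_le f g z).trans
            (add_le_add (le_ciSup (bddAbove_weightedDeriv f) z)
              (le_ciSup (bddAbove_weightedDeriv g) z))
        have h0 : ‖((f + g : LittleBloch) : ℂ → ℂ) 0‖ ≤
            ‖(f : ℂ → ℂ) 0‖ + ‖(g : ℂ → ℂ) 0‖ := norm_add_le _ _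
        unfold blochNorm
        linarith
      neg' := by
        intro f
        have h : ∀ z, weightedDeriv (-f) z = weightedDeriv f z := by
          intro z
          unfold weightedDeriv
          rw [coe_neg, deriv.neg, norm_neg]
        simp [blochNorm, coe_neg, h]
      eq_zero_of_map_eq_zero' := by
        intro f hf
        have hs : 0 ≤ ⨆ z : disc, weightedDeriv f z :=
          Real.iSup_nonneg (weightedDeriv_nonneg f)
        have hf' : ‖(f : ℂ → ℂ) 0‖ + ⨆ z : disc, weightedDeriv f z = 0 := hf
        have h0 : (f : ℂ → ℂ) 0 = 0 := by
          rw [← norm_eq_zero]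
          linarith [norm_nonneg ((f : ℂ → ℂ) 0)]
        have hs0 : ⨆ z : disc, weightedDeriv f z = 0 := by
          linarith [norm_nonneg ((f : ℂ → ℂ) 0)]
        have hd : ∀ z ∈ disc, deriv (f : ℂ → ℂ) z = 0 := by
          intro z hz
          have h1 : weightedDeriv f ⟨z, hz⟩ ≤ 0 := by
            rw [← hs0]
            exact le_ciSup (bddAbove_weightedDeriv f) _
          have h2 := le_antisymm h1 (weightedDeriv_nonneg f _)
          rcases mul_eq_zero.1 h2 with h3 | h3
          · exact absurd h3 (one_sub_norm_pos ⟨z, hz⟩).ne'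
          · exact norm_eq_zero.1 h3
        apply Subtype.ext
        funext z
        by_cases hz : z ∈ disc
        · have := Metric.isOpen_ball.is_const_of_deriv_eq_zero
            (convex_ball (0 : ℂ) 1).isPreconnected f.2.1 hd hz (Metric.mem_ball_self one_pos)
          rw [this, h0]
          rfl
        · exact f.2.2.1 z hz }

/-- An analytic polynomial, as an element of the little Bloch space. -/
def ofPolynomial (Q : Polynomial ℂ) : LittleBloch :=
  ⟨disc.indicator fun z => Q.eval z, by
    have heq : EqOn (disc.indicator fun z => Q.eval z) (fun z => Q.eval z) disc :=
      fun z hz => indicator_of_mem hz _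
    refine ⟨Q.differentiable.differentiableOn.congr heq,
      fun z hz => indicator_of_notMem hz _, ?_⟩
    have hev : ∀ᶠ z : ℂ in comap norm (𝓝[<] (1 : ℝ)), z ∈ disc := by
      filter_upwards [preimage_mem_comap (self_mem_nhdsWithin : Iio (1 : ℝ) ∈ 𝓝[<] (1 : ℝ))]
        with z hz
      simpa using hz
    obtain ⟨C, hC⟩ := (isCompact_closedBall (0 : ℂ) 1).exists_bound_of_continuousOn
      (f := fun z => Q.derivative.eval z) Q.derivative.continuous.continuousOn
    have hlim : Tendsto (fun z : ℂ => (1 - ‖z‖) * C) (comap norm (𝓝[<] (1 : ℝ))) (𝓝 0) := by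
      have h1 : Tendsto (fun t : ℝ => (1 - t) * C) (𝓝 1) (𝓝 ((1 - 1) * C)) :=
        Continuous.tendsto (by fun_prop) 1
      rw [sub_self, zero_mul] at h1
      exact (h1.mono_left nhdsWithin_le_nhds).comp tendsto_comap
    refine squeeze_zero_norm' ?_ hlim
    filter_upwards [hev] with z hz
    have hz1 : 0 ≤ 1 - ‖z‖ := (one_sub_norm_pos ⟨z, hz⟩).le
    have hd : deriv (disc.indicator fun z => Q.eval z) z = Q.derivative.eval z := by
      rw [(heq.eventuallyEq_of_mem (Metric.isOpen_ball.mem_nhds hz)).deriv_eq, Q.deriv]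
    rw [hd, norm_mul, Complex.norm_real, Real.norm_of_nonneg hz1]
    exact mul_le_mul_of_nonneg_left (hC z (Metric.ball_subset_closedBall hz)) hz1⟩

end LittleBloch

/-- The space `L^∞(E)` of essentially bounded functions on a subset `E` of the unit circle
(with respect to `dm`); this copy carries the weak-star topology. -/
def WeakStarLinfty (E : Set ℂ) : Type := Lp ℂ ∞ (circleMeasure.restrict E)

namespace WeakStarLinfty

/-- The underlying element of `L^∞(E)`. -/
def toLinfty {E : Set ℂ} (g : WeakStarLinfty E) : Lp ℂ ∞ (circleMeasure.restrict E) := g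

/-- The pairing `∫_E g h dm` of `g ∈ L^∞(E)` with `h ∈ L^1(E)`. -/
def pairing {E : Set ℂ} (g : WeakStarLinfty E) (h : Lp ℂ 1 (circleMeasure.restrict E)) : ℂ :=
  ∫ ζ in E, g.toLinfty ζ * h ζ ∂circleMeasure

/-- The weak-star topology: the coarsest one that makes `g ↦ ∫_E g h dm` continuous for every
`h ∈ L^1(E)`. -/
instance (E : Set ℂ) : TopologicalSpace (WeakStarLinfty E) :=
  TopologicalSpace.induced pairing Pi.topologicalSpace

theorem memLp_polynomial (E : Set ℂ) (Q : Polynomial ℂ) :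
    MemLp (fun ζ => Q.eval ζ) ∞ (circleMeasure.restrict E) := by
  obtain ⟨C, hC⟩ := (isCompact_sphere (0 : ℂ) 1).exists_bound_of_continuousOn
    (f := fun z => Q.eval z) Q.continuous.continuousOn
  refine memLp_top_of_bound Q.continuous.aestronglyMeasurable C ?_
  exact ae_restrict_of_ae (ae_mem_unitCircle.mono hC)

/-- (The restriction to `E` of) an analytic polynomial, as an element of `L^∞(E)`. -/
def ofPolynomial (E : Set ℂ) (Q : Polynomial ℂ) : WeakStarLinfty E :=
  (memLp_polynomial E Q).toLp (fun ζ => Q.eval ζ)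

end WeakStarLinfty

/-- `𝒫_E(ℬ₀)`: the closure of `{(Q, Q) : Q an analytic polynomial}` in `ℬ₀ ⊕ L^∞(E)`, for the norm
topology on the first summand and the weak-star topology on the second. -/
def simultaneousClosure (E : Set ℂ) : Set (LittleBloch × WeakStarLinfty E) :=
  closure (range fun Q : Polynomial ℂ =>
    (LittleBloch.ofPolynomial Q, WeakStarLinfty.ofPolynomial E Q))

/-- `E` has the SA-property (simultaneous approximation) with respect to `ℬ₀`:
`𝒫_E(ℬ₀) = ℬ₀ ⊕ L^∞(E)`. -/
def HasSAProperty (E : Set ℂ) : Prop :=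
  simultaneousClosure E = univ

/-- The analytic Sobolev space `W^p_a(Ω)` of an open set `Ω`: functions holomorphic in `Ω` whose
derivative is `p`-integrable over `Ω` with respect to area. Values outside `Ω` are irrelevant. -/
def AnalyticSobolev (p : ℝ≥0∞) (Ω : Set ℂ) : Set (ℂ → ℂ) :=
  {F | DifferentiableOn ℂ F Ω ∧ MemLp (deriv F) p (volume.restrict Ω)}

/-- `K` is removable for `W^p_a`: the space `W^p_a(ℂ \ K)` consists of constants only. -/
def IsRemovable (p : ℝ≥0∞) (K : Set ℂ) : Prop :=
  ∀ F ∈ AnalyticSobolev p Kᶜ, ∃ c : ℂ, ∀ z ∈ Kᶜ, F z = c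

end BlochSA

end

/-!
A function `F ∈ W¹_a(ℂ \ K)` has radial boundary values `T₊` (from inside) and `T₋` (from outside)
almost everywhere on the circle: by Fubini in polar coordinates, `F'` is integrable on almost every
ray, and the resulting limits are limits in `L¹` as well (`exists_integrable_majorant`,
`tendsto_circleIntegral_interiorTrace`, `tendsto_circleIntegral_exteriorTrace`). The jump
`h = T₊ - T₋` is in `L¹` and is carried by `K`.

For a polynomial `Q`, Cauchy's theorem in the disc gives
`∫_K Q h ζ dm = -(2πi)⁻¹ ∮_{|z|=2} Q F dz`
(`integral_eval_mul_jump`). A Littlewood–Paley type identity in the exterior domain turns the right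
side into an area integral of `F'` against `Q'` at the reflected point `1 / conj z`, with a
weight that vanishes to first order on the circle
(`integral_radialWeight_mul_reflectedPairing`). Hence `|∫_K Q h ζ dm| ≤ C ‖Q‖` with the Bloch norm,
because `F'` is integrable (`exists_norm_circleIntegral_le`).

If `K` has the SA-property, then polynomials `Q` that tend to `0` in the Bloch norm can approximate
any `g ∈ L^∞(K)` weak-star, so `∫_K g h ζ dm = 0` for all `g`, and `h = 0` almost everywhere
(`HasSAProperty.ae_eq_zero`). Without a jump, `F` is given at every point off the circle
by its Cauchy integral over each large circle `|w| = R`. Since the integral means of `|F|` over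
these circles stay bounded, `F z - F 0 = O(1/R)`, and `F` is constant (`eq_of_traces_ae_eq`).
-/

namespace BlochSA

/-! ### Integration in polar coordinates -/

theorem circleMap_zero_eq_mul (r θ : ℝ) : circleMap 0 r θ = r * circleMap 0 1 θ := by
  simp [circleMap]

theorem circleMap_zero_add_pi (r θ : ℝ) : circleMap 0 r (θ + Real.pi) = -circleMap 0 r θ := by
  simp [circleMap, add_mul, Complex.exp_add, Complex.exp_pi_mul_I]

theorem continuous_uncurry_circleMap : Continuous fun p : ℝ × ℝ => circleMap 0 p.1 p.2 := by
  unfold circleMap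
  fun_prop

/-- Integration in polar coordinates, with the angle in `(0, 2π]`. -/
theorem integrable_polar {f : ℂ → ℂ} (hm : Measurable f) (hf : Integrable f) :
    Integrable (fun p : ℝ × ℝ => (p.1 : ℂ) * f (circleMap 0 p.1 p.2))
      ((volume.restrict (Ioi 0)).prod (volume.restrict (Ioc 0 (2 * Real.pi)))) := by
  have hmeas : Measurable fun p : ℝ × ℝ => (p.1 : ℂ) * f (circleMap 0 p.1 p.2) :=
    (Complex.measurable_ofReal.comp measurable_fst).mul
      (hm.comp continuous_uncurry_circleMap.measurable)
  -- Mathlib's angles lie in `(-π, π)`; rotating the plane by `π` moves them to `(0, 2π)`.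
  have hneg : Integrable fun z => f (-z) := hf.comp_neg
  have h1 : Integrable (fun p : ℝ × ℝ => (p.1 : ℂ) * f (-circleMap 0 p.1 p.2))
      ((volume.restrict (Ioi 0)).prod (volume.restrict (Ioo (-Real.pi) Real.pi))) := by
    refine ⟨((Complex.measurable_ofReal.comp measurable_fst).mul
      (hm.comp continuous_uncurry_circleMap.measurable.neg)).aestronglyMeasurable, ?_⟩
    have h2 := Complex.lintegral_comp_polarCoord_symm fun z => ‖f (-z)‖ₑ
    rw [Measure.prod_restrict, ← Measure.volume_eq_prod]
    have h3 : ∫⁻ p in polarCoord.target, ‖(p.1 : ℂ) * f (-circleMap 0 p.1 p.2)‖ₑ =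
        ∫⁻ z, ‖f (-z)‖ₑ := by
      rw [← h2]
      refine setLIntegral_congr_fun polarCoord.open_target.measurableSet fun p hp => ?_
      have hp0 : 0 < p.1 := hp.1
      have : Complex.polarCoord.symm p = circleMap 0 p.1 p.2 := by
        simp [circleMap, Complex.exp_mul_I]
      simp only [this, enorm_mul, smul_eq_mul]
      congr 1
      rw [← ofReal_norm, Complex.norm_real, Real.norm_of_nonneg hp0.le]
    exact h3.trans_lt hneg.2
  have hmp : MeasurePreserving (fun θ : ℝ => θ + Real.pi)
      (volume.restrict (Ioo (-Real.pi) Real.pi)) (volume.restrict (Ioc 0 (2 * Real.pi))) := by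
    rw [← Measure.restrict_congr_set (Ioo_ae_eq_Ioc (μ := volume) (a := 0) (b := 2 * Real.pi))]
    have := (measurePreserving_add_right (volume : Measure ℝ) Real.pi).restrict_preimage
      (measurableSet_Ioo (a := 0) (b := 2 * Real.pi))
    convert this using 2
    ext θ
    simp only [mem_Ioo, mem_preimage]
    constructor <;> rintro ⟨h1, h2⟩ <;> constructor <;> linarith
  have hmp2 := (MeasurePreserving.id (volume.restrict (Ioi (0 : ℝ)))).prod hmp
  refine (hmp2.integrable_comp hmeas.aestronglyMeasurable).1 ?_
  refine h1.congr (Eventually.of_forall fun p => ?_)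
  simp [circleMap_zero_add_pi]

/-- Away from the origin the Jacobian factor `r` in polar coordinates can be dropped. -/
theorem integrable_radial {f : ℂ → ℂ} (hm : Measurable f) (hf : Integrable f) {a : ℝ}
    (ha : 0 < a) :
    Integrable (fun p : ℝ × ℝ => f (circleMap 0 p.1 p.2))
      ((volume.restrict (Ioi a)).prod (volume.restrict (Ioc 0 (2 * Real.pi)))) := by
  have h1 := (integrable_polar hm hf).mono_measure
    (Measure.prod_mono (Measure.restrict_mono (Ioi_subset_Ioi ha.le) le_rfl) le_rfl :
      (volume.restrict (Ioi a)).prod (volume.restrict (Ioc 0 (2 * Real.pi))) ≤ _)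
  refine (h1.norm.const_mul a⁻¹).mono
    (hm.comp continuous_uncurry_circleMap.measurable).aestronglyMeasurable ?_
  rw [Measure.prod_restrict]
  filter_upwards [ae_restrict_mem (measurableSet_Ioi.prod measurableSet_Ioc)] with p hp
  have hp1 : a < p.1 := hp.1
  rw [norm_mul, norm_norm, norm_mul, Complex.norm_real,
    Real.norm_of_nonneg (inv_nonneg.2 ha.le), Real.norm_of_nonneg (ha.trans hp1).le, ← mul_assoc]
  refine le_mul_of_one_le_left (norm_nonneg _) ?_
  rw [inv_mul_eq_div, one_le_div ha]
  exact hp1.le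

/-! ### Radial boundary values -/

/-- The radial limit at `ζ` of `F` from inside the unit disc, written as the value at `ζ / 2` plus
the integral of `F'` along the rest of the radius. -/
noncomputable def interiorTrace (F : ℂ → ℂ) (ζ : ℂ) : ℂ :=
  F ((1 / 2 : ℝ) * ζ) + ζ * ∫ s in (1 / 2 : ℝ)..1, deriv F (s * ζ)

/-- The radial limit at `ζ` of `F` from outside the unit disc, written as the value at `2ζ` minus
the integral of `F'` along the segment from `ζ` to `2ζ`. -/
noncomputable def exteriorTrace (F : ℂ → ℂ) (ζ : ℂ) : ℂ :=
  F ((2 : ℝ) * ζ) - ζ * ∫ s in (1 : ℝ)..2, deriv F (s * ζ)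

/-- The fundamental theorem of calculus along a ray. -/
theorem sub_eq_mul_integral_deriv {F : ℂ → ℂ} {ζ : ℂ} {a b : ℝ}
    (h : ∀ s ∈ uIcc a b, AnalyticAt ℂ F (s * ζ)) :
    F (b * ζ) - F (a * ζ) = ζ * ∫ s in a..b, deriv F (s * ζ) := by
  have hd : ∀ s ∈ uIcc a b, HasDerivAt (fun t : ℝ => F (t * ζ)) (ζ * deriv F (s * ζ)) s := by
    intro s hs
    have h1 := (h s hs).differentiableAt.hasDerivAt
    have h2 : HasDerivAt (fun t : ℝ => (t : ℂ) * ζ) ζ s := by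
      simpa using (Complex.ofRealCLM.hasDerivAt (x := s)).mul_const ζ
    have h3 := h1.comp s h2
    rw [mul_comm] at h3
    exact h3
  have hc : ContinuousOn (fun s : ℝ => ζ * deriv F (s * ζ)) (uIcc a b) := by
    refine continuousOn_const.mul fun s hs => ContinuousAt.continuousWithinAt ?_
    exact ContinuousAt.comp (f := fun s : ℝ => (s : ℂ) * ζ) (h s hs).deriv.continuousAt
      (by fun_prop)
  rw [← intervalIntegral.integral_const_mul,
    intervalIntegral.integral_eq_sub_of_hasDerivAt hd hc.intervalIntegrable]

theorem norm_circleMap_of_nonneg {r θ : ℝ} (hr : 0 ≤ r) : ‖circleMap 0 r θ‖ = r := by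
  simp [abs_of_nonneg hr]

theorem norm_ofReal_mul_circleMap {r θ : ℝ} (hr : 0 ≤ r) : ‖(r : ℂ) * circleMap 0 1 θ‖ = r := by
  rw [← circleMap_zero_eq_mul, norm_circleMap_of_nonneg hr]

theorem analyticAt_of_norm_ne_one {F : ℂ → ℂ} (hF : DifferentiableOn ℂ F unitCircleᶜ) {z : ℂ}
    (hz : ‖z‖ ≠ 1) : AnalyticAt ℂ F z :=
  hF.analyticAt (Metric.isClosed_sphere.isOpen_compl.mem_nhds (by simpa using hz))

/-- On almost every ray, `F'` is integrable away from the origin. -/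
theorem ae_integrableOn_ray {f : ℂ → ℂ} (hm : Measurable f) (hf : Integrable f) :
    ∀ᵐ θ ∂volume.restrict (Ioc 0 (2 * Real.pi)),
      IntegrableOn (fun s : ℝ => f (s * circleMap 0 1 θ)) (Ioi (1 / 4)) := by
  have := (integrable_radial hm hf (a := 1 / 4) (by norm_num)).prod_left_ae
  filter_upwards [this] with θ hθ
  exact hθ.congr (Eventually.of_forall fun s => congrArg f (circleMap_zero_eq_mul s θ))

theorem integrable_integral_norm_ray {f : ℂ → ℂ} (hm : Measurable f) (hf : Integrable f) :
    Integrable (fun θ : ℝ => ∫ s in Ioi (1 / 4 : ℝ), ‖f (s * circleMap 0 1 θ)‖)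
      (volume.restrict (Ioc 0 (2 * Real.pi))) := by
  have := (integrable_radial hm hf (a := 1 / 4) (by norm_num)).integral_norm_prod_right
  simpa only [← circleMap_zero_eq_mul] using this

theorem norm_integral_ray_le {g : ℝ → ℂ} (hg : IntegrableOn g (Ioi (1 / 4))) {a b : ℝ}
    (ha : 1 / 4 ≤ a) (hb : 1 / 4 ≤ b) :
    ‖∫ s in a..b, g s‖ ≤ ∫ s in Ioi (1 / 4 : ℝ), ‖g s‖ := by
  refine intervalIntegral.norm_integral_le_integral_norm_uIoc.trans ?_
  refine setIntegral_mono_set hg.norm (Eventually.of_forall fun _ => norm_nonneg _) ?_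
  refine LE.le.eventuallyLE fun s hs => ?_
  exact (le_min ha hb).trans_lt hs.1

theorem tendsto_interiorTrace {F : ℂ → ℂ} (hF : DifferentiableOn ℂ F unitCircleᶜ)
    {θ : ℝ} (hθ : IntegrableOn (fun s : ℝ => deriv F (s * circleMap 0 1 θ)) (Ioi (1 / 4))) :
    Tendsto (fun r => F (circleMap 0 r θ)) (𝓝[<] 1) (𝓝 (interiorTrace F (circleMap 0 1 θ))) := by
  have hii : IntegrableOn (fun s : ℝ => deriv F (s * circleMap 0 1 θ)) (uIcc (1 / 2) 1) :=
    hθ.mono_set fun s hs => by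
      rw [uIcc_of_le (by norm_num)] at hs
      exact lt_of_lt_of_le (by norm_num) hs.1
  have hc := (intervalIntegral.continuousOn_primitive_interval hii) 1 right_mem_uIcc
  rw [uIcc_of_le (by norm_num)] at hc
  have hc' := (hc.mono_of_mem_nhdsWithin (s := Iio 1)
    (mem_of_superset (Ioo_mem_nhdsLT (by norm_num : (1 / 2 : ℝ) < 1)) Ioo_subset_Icc_self)).tendsto
  have := (hc'.const_mul (circleMap 0 1 θ)).const_add (F ((1 / 2 : ℝ) * circleMap 0 1 θ))
  refine this.congr' ?_
  filter_upwards [Ioo_mem_nhdsLT (by norm_num : (1 / 2 : ℝ) < 1)] with r hr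
  rw [circleMap_zero_eq_mul r, ← sub_eq_mul_integral_deriv]
  · ring
  · intro s hs
    rw [uIcc_of_le hr.1.le] at hs
    refine analyticAt_of_norm_ne_one hF ?_
    rw [norm_ofReal_mul_circleMap (le_trans (by norm_num) hs.1)]
    exact (hs.2.trans_lt hr.2).ne

theorem tendsto_exteriorTrace {F : ℂ → ℂ} (hF : DifferentiableOn ℂ F unitCircleᶜ)
    {θ : ℝ} (hθ : IntegrableOn (fun s : ℝ => deriv F (s * circleMap 0 1 θ)) (Ioi (1 / 4))) :
    Tendsto (fun r => F (circleMap 0 r θ)) (𝓝[>] 1) (𝓝 (exteriorTrace F (circleMap 0 1 θ))) := by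
  have hii : IntegrableOn (fun s : ℝ => deriv F (s * circleMap 0 1 θ)) (uIcc 1 2) :=
    hθ.mono_set fun s hs => by
      rw [uIcc_of_le (by norm_num)] at hs
      exact lt_of_lt_of_le (by norm_num) hs.1
  have hc := (intervalIntegral.continuousOn_primitive_interval_left hii) 1 left_mem_uIcc
  rw [uIcc_of_le (by norm_num)] at hc
  have hc' := (hc.mono_of_mem_nhdsWithin (s := Ioi 1)
    (mem_of_superset (Ioo_mem_nhdsGT (by norm_num : (1 : ℝ) < 2)) Ioo_subset_Icc_self)).tendsto
  have := (hc'.const_mul (circleMap 0 1 θ)).const_sub (F ((2 : ℝ) * circleMap 0 1 θ))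
  refine this.congr' ?_
  filter_upwards [Ioo_mem_nhdsGT (by norm_num : (1 : ℝ) < 2)] with r hr
  rw [circleMap_zero_eq_mul r, ← sub_eq_mul_integral_deriv]
  · ring
  · intro s hs
    rw [uIcc_of_le hr.2.le] at hs
    have h1 : 1 < s := hr.1.trans_le hs.1
    refine analyticAt_of_norm_ne_one hF ?_
    rw [norm_ofReal_mul_circleMap (by linarith)]
    exact h1.ne'

theorem continuous_comp_circleMap {F : ℂ → ℂ} (hF : DifferentiableOn ℂ F unitCircleᶜ) {r : ℝ}
    (hr : 0 ≤ r) (hr1 : r ≠ 1) : Continuous fun θ => F (circleMap 0 r θ) :=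
  continuous_iff_continuousAt.2 fun θ => ContinuousAt.comp (f := circleMap 0 r)
    (analyticAt_of_norm_ne_one hF (by rwa [norm_circleMap_of_nonneg hr])).continuousAt
    (continuous_circleMap 0 r).continuousAt

/-- The values of `F` on all circles `|z| = r`, `r ≥ 1/2`, `r ≠ 1`, have a common integrable
majorant in the angular variable. -/
theorem exists_integrable_majorant {F : ℂ → ℂ} (hF : DifferentiableOn ℂ F unitCircleᶜ)
    (hI : Integrable (deriv F)) :
    ∃ B : ℝ → ℝ, Integrable B (volume.restrict (Ioc 0 (2 * Real.pi))) ∧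
      ∀ᵐ θ ∂volume.restrict (Ioc 0 (2 * Real.pi)), ∀ r : ℝ, 1 / 2 ≤ r → r ≠ 1 →
        ‖F (circleMap 0 r θ)‖ ≤ B θ := by
  have hm := measurable_deriv F
  have hcont : ∀ r : ℝ, 0 ≤ r → r ≠ 1 → ∃ M, ∀ θ, ‖F (circleMap 0 r θ)‖ ≤ M := by
    intro r hr hr1
    obtain ⟨M, hM⟩ := (isCompact_sphere (0 : ℂ) r).exists_bound_of_continuousOn (f := F)
      fun z hz => (analyticAt_of_norm_ne_one hF
        (by rwa [mem_sphere_zero_iff_norm.1 hz])).continuousAt.continuousWithinAt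
    exact ⟨M, fun θ => hM _ (circleMap_mem_sphere 0 hr θ)⟩
  obtain ⟨M₁, hM₁⟩ := hcont (1 / 2) (by norm_num) (by norm_num)
  obtain ⟨M₂, hM₂⟩ := hcont 2 (by norm_num) (by norm_num)
  refine ⟨fun θ => max M₁ M₂ + ∫ s in Ioi (1 / 4 : ℝ), ‖deriv F (s * circleMap 0 1 θ)‖,
    (integrable_const _).add (integrable_integral_norm_ray hm hI), ?_⟩
  filter_upwards [ae_integrableOn_ray hm hI] with θ hθ r hr hr1
  have key : ∀ a : ℝ, 1 / 2 ≤ a → ‖F (circleMap 0 a θ)‖ ≤ max M₁ M₂ →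
      (∀ s ∈ uIcc a r, s ≠ 1) → ‖F (circleMap 0 r θ)‖ ≤
        max M₁ M₂ + ∫ s in Ioi (1 / 4 : ℝ), ‖deriv F (s * circleMap 0 1 θ)‖ := by
    intro a ha hFa hs
    have h1 : F (r * circleMap 0 1 θ) - F (a * circleMap 0 1 θ) =
        circleMap 0 1 θ * ∫ s in a..r, deriv F (s * circleMap 0 1 θ) := by
      refine sub_eq_mul_integral_deriv fun s hs' => analyticAt_of_norm_ne_one hF ?_
      rw [norm_ofReal_mul_circleMap (le_trans (by norm_num) ((le_min ha hr).trans hs'.1))]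
      exact hs s hs'
    rw [← circleMap_zero_eq_mul, ← circleMap_zero_eq_mul, sub_eq_iff_eq_add'] at h1
    rw [h1]
    refine (norm_add_le _ _).trans (add_le_add hFa ?_)
    rw [norm_mul, norm_circleMap_of_nonneg zero_le_one, one_mul]
    exact norm_integral_ray_le hθ (by linarith) (by linarith)
  rcases lt_or_gt_of_ne hr1 with h | h
  · refine key (1 / 2) le_rfl ((hM₁ θ).trans (le_max_left _ _)) fun s hs => ?_
    rw [uIcc_of_le hr] at hs
    exact (hs.2.trans_lt h).ne
  · refine key 2 (by norm_num) ((hM₂ θ).trans (le_max_right _ _)) fun s hs => ?_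
    exact ((lt_min (by norm_num) h).trans_le hs.1).ne'

/-- Dominated convergence for circle integrals over circles that approach the unit circle. -/
theorem tendsto_circleIntegral_mul {F T φ : ℂ → ℂ} {l : Filter ℝ} [l.IsCountablyGenerated]
    (hl : l ≤ 𝓝 1) {S : Set ℂ} (hS : IsCompact S) (hSl : ∀ᶠ r in l, ∀ θ, circleMap 0 r θ ∈ S)
    (hS1 : unitCircle ⊆ S) (hφ : ContinuousOn φ S) {B : ℝ → ℝ}
    (hB : Integrable B (volume.restrict (Ioc 0 (2 * Real.pi))))
    (hF : ∀ᶠ r in l, Continuous fun θ => F (circleMap 0 r θ))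
    (hbd : ∀ᶠ r in l, ∀ᵐ θ ∂volume.restrict (Ioc 0 (2 * Real.pi)),
      ‖F (circleMap 0 r θ)‖ ≤ B θ)
    (hlim : ∀ᵐ θ ∂volume.restrict (Ioc 0 (2 * Real.pi)),
      Tendsto (fun r => F (circleMap 0 r θ)) l (𝓝 (T (circleMap 0 1 θ)))) :
    Tendsto (fun r => ∮ z in C(0, r), φ z * F z) l (𝓝 (∮ z in C(0, 1), φ z * T z)) := by
  obtain ⟨C, hC⟩ := hS.exists_bound_of_continuousOn hφ
  have hC0 : 0 ≤ C :=
    (norm_nonneg _).trans (hC _ (hS1 (circleMap_mem_sphere 0 zero_le_one 0)))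
  have h2 : ∀ᶠ r in l, |r| ≤ 2 := by
    have : ∀ᶠ r : ℝ in 𝓝 1, |r| < 2 :=
      continuous_abs.continuousAt.eventually (gt_mem_nhds (by norm_num))
    exact hl (this.mono fun _ h => h.le)
  have hmap : ∀ θ, Tendsto (fun r => circleMap 0 r θ) l (𝓝 (circleMap 0 1 θ)) := by
    intro θ
    have : Continuous fun r => circleMap 0 r θ := by unfold circleMap; fun_prop
    exact (this.tendsto 1).mono_left hl
  simp only [circleIntegral, intervalIntegral.integral_of_le Real.two_pi_pos.le, deriv_circleMap,
    smul_eq_mul]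
  refine tendsto_integral_filter_of_dominated_convergence (fun θ => 2 * (C * B θ)) ?_ ?_
    ((hB.const_mul C).const_mul 2) ?_
  · filter_upwards [hSl, hF] with r hr hFr
    have h1 : Continuous fun θ => φ (circleMap 0 r θ) :=
      hφ.comp_continuous (continuous_circleMap 0 r) hr
    exact (((continuous_circleMap 0 r).mul continuous_const).mul
      (h1.mul hFr)).aestronglyMeasurable
  · filter_upwards [hSl, hbd, h2] with r hr hBr hr2
    filter_upwards [hBr] with θ hθ
    rw [norm_mul, norm_mul, norm_mul, Complex.norm_I, mul_one, norm_circleMap_zero]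
    have h3 := hC _ (hr θ)
    gcongr
  · filter_upwards [hlim] with θ hθ
    refine ((hmap θ).mul_const _).mul (Tendsto.mul ?_ hθ)
    have h1 := hφ _ (hS1 (circleMap_mem_sphere 0 zero_le_one θ))
    exact h1.tendsto.comp (tendsto_nhdsWithin_iff.2 ⟨hmap θ, hSl.mono fun r hr => hr θ⟩)

theorem isCompact_annulus (a b : ℝ) : IsCompact {z : ℂ | a ≤ ‖z‖ ∧ ‖z‖ ≤ b} := by
  refine (isCompact_closedBall (0 : ℂ) b).of_isClosed_subset ?_ fun z hz => by simpa using hz.2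
  exact (isClosed_le continuous_const continuous_norm).inter
    (isClosed_le continuous_norm continuous_const)

theorem tendsto_circleIntegral_interiorTrace {F φ : ℂ → ℂ}
    (hF : DifferentiableOn ℂ F unitCircleᶜ) (hI : Integrable (deriv F)) {a : ℝ} (ha : a < 1)
    (hφ : ContinuousOn φ {z | a ≤ ‖z‖ ∧ ‖z‖ ≤ 1}) :
    Tendsto (fun r => ∮ z in C(0, r), φ z * F z) (𝓝[<] 1)
      (𝓝 (∮ z in C(0, 1), φ z * interiorTrace F z)) := by
  obtain ⟨B, hB, hBd⟩ := exists_integrable_majorant hF hI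
  have hev : ∀ᶠ r : ℝ in 𝓝[<] 1, r ∈ Ioo (max a (1 / 2)) 1 :=
    Ioo_mem_nhdsLT (max_lt ha (by norm_num))
  refine tendsto_circleIntegral_mul nhdsWithin_le_nhds (isCompact_annulus a 1) ?_ ?_ hφ hB ?_ ?_ ?_
  · filter_upwards [hev] with r hr θ
    have h0 : 1 / 2 < r := (le_max_right _ _).trans_lt hr.1
    have h1 : a < r := (le_max_left _ _).trans_lt hr.1
    rw [norm_circleMap_of_nonneg (by linarith)]
    exact ⟨h1.le, hr.2.le⟩
  · intro z hz
    rw [mem_ofPred_eq, mem_sphere_zero_iff_norm.1 hz]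
    exact ⟨ha.le, le_rfl⟩
  · filter_upwards [hev] with r hr
    have h0 : 1 / 2 < r := (le_max_right _ _).trans_lt hr.1
    exact continuous_comp_circleMap hF (by linarith) hr.2.ne
  · filter_upwards [hev] with r hr
    filter_upwards [hBd] with θ hθ
    exact hθ r ((le_max_right _ _).trans hr.1.le) hr.2.ne
  · filter_upwards [ae_integrableOn_ray (measurable_deriv F) hI] with θ hθ
    exact tendsto_interiorTrace hF hθ

theorem tendsto_circleIntegral_exteriorTrace {F φ : ℂ → ℂ}
    (hF : DifferentiableOn ℂ F unitCircleᶜ) (hI : Integrable (deriv F)) {b : ℝ} (hb : 1 < b)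
    (hφ : ContinuousOn φ {z | 1 ≤ ‖z‖ ∧ ‖z‖ ≤ b}) :
    Tendsto (fun r => ∮ z in C(0, r), φ z * F z) (𝓝[>] 1)
      (𝓝 (∮ z in C(0, 1), φ z * exteriorTrace F z)) := by
  obtain ⟨B, hB, hBd⟩ := exists_integrable_majorant hF hI
  have hev : ∀ᶠ r : ℝ in 𝓝[>] 1, r ∈ Ioo 1 b := Ioo_mem_nhdsGT hb
  refine tendsto_circleIntegral_mul nhdsWithin_le_nhds (isCompact_annulus 1 b) ?_ ?_ hφ hB ?_ ?_ ?_
  · filter_upwards [hev] with r hr θ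
    have h1 : 1 < r := hr.1
    rw [norm_circleMap_of_nonneg (by linarith)]
    exact ⟨h1.le, hr.2.le⟩
  · intro z hz
    rw [mem_ofPred_eq, mem_sphere_zero_iff_norm.1 hz]
    exact ⟨le_rfl, hb.le⟩
  · filter_upwards [hev] with r hr
    have h1 : 1 < r := hr.1
    exact continuous_comp_circleMap hF (by linarith) h1.ne'
  · filter_upwards [hev] with r hr
    have h1 : 1 < r := hr.1
    filter_upwards [hBd] with θ hθ
    exact hθ r (by linarith) h1.ne'
  · filter_upwards [ae_integrableOn_ray (measurable_deriv F) hI] with θ hθ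
    exact tendsto_exteriorTrace hF hθ

/-! ### Circle integrals in the exterior domain -/

/-- Cauchy's theorem for annuli contained in `|z| > 1`, with countably many exceptional points. -/
theorem circleIntegral_eq_of_differentiable_annulus {f : ℂ → ℂ} {r R : ℝ} (hr : 0 < r) (hrR : r ≤ R)
    {s : Set ℂ} (hs : s.Countable) (hc : ∀ z, r ≤ ‖z‖ → ‖z‖ ≤ R → ContinuousAt f z)
    (hd : ∀ z, z ∉ s → r < ‖z‖ → ‖z‖ < R → DifferentiableAt ℂ f z) :
    (∮ z in C(0, R), f z) = ∮ z in C(0, r), f z := by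
  refine Complex.circleIntegral_eq_of_differentiable_on_annulus_off_countable hr hrR hs ?_ ?_
  · intro z hz
    refine (hc z ?_ ?_).continuousWithinAt
    · simpa using hz.2
    · simpa using hz.1
  · intro z hz
    refine hd z hz.2 ?_ ?_
    · simpa using hz.1.2
    · simpa using hz.1.1

/-- For `φ` holomorphic on `1 ≤ |z| ≤ b`, the integral of `φ F` over a circle in that annulus is the
integral of `φ` against the exterior trace of `F`. -/
theorem circleIntegral_eq_exteriorTrace {F φ : ℂ → ℂ}
    (hF : DifferentiableOn ℂ F unitCircleᶜ) (hI : Integrable (deriv F)) {b : ℝ}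
    (hφ : ∀ z, 1 ≤ ‖z‖ → ‖z‖ ≤ b → DifferentiableAt ℂ φ z) {R : ℝ} (hR : 1 < R) (hRb : R ≤ b) :
    (∮ z in C(0, R), φ z * F z) = ∮ z in C(0, 1), φ z * exteriorTrace F z := by
  refine tendsto_nhds_unique (f := fun r => ∮ z in C(0, r), φ z * F z) (l := 𝓝[>] (1 : ℝ)) ?_
    (tendsto_circleIntegral_exteriorTrace hF hI (hR.trans_le hRb) fun z hz =>
      (hφ z hz.1 hz.2).continuousAt.continuousWithinAt)
  refine tendsto_const_nhds.congr' ?_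
  filter_upwards [Ioo_mem_nhdsGT hR] with r hr
  have hd : ∀ z, r ≤ ‖z‖ → ‖z‖ ≤ R → DifferentiableAt ℂ (fun z => φ z * F z) z :=
    fun z h1 h2 => (hφ z (hr.1.le.trans h1) (h2.trans hRb)).mul
      (analyticAt_of_norm_ne_one hF (hr.1.trans_le h1).ne').differentiableAt
  exact circleIntegral_eq_of_differentiable_annulus (by linarith [hr.1]) hr.2.le countable_empty
    (fun z h1 h2 => (hd z h1 h2).continuousAt) fun z _ h1 h2 => hd z h1.le h2.le

theorem circleIntegral_pow_mul_eq {F : ℂ → ℂ} (hF : DifferentiableOn ℂ F unitCircleᶜ) (k : ℕ)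
    {r R : ℝ} (hr : 1 < r) (hR : 1 < R) :
    (∮ z in C(0, R), z ^ k * F z) = ∮ z in C(0, r), z ^ k * F z := by
  wlog h : r ≤ R generalizing r R
  · exact (this hR hr (not_le.1 h).le).symm
  have hd : ∀ z, r ≤ ‖z‖ → DifferentiableAt ℂ (fun z => z ^ k * F z) z :=
    fun z h1 => (by fun_prop : DifferentiableAt ℂ (fun z : ℂ => z ^ k) z).mul
      (analyticAt_of_norm_ne_one hF (hr.trans_le h1).ne').differentiableAt
  exact circleIntegral_eq_of_differentiable_annulus (by linarith) h countable_empty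
    (fun z h1 _ => (hd z h1).continuousAt) fun z _ h1 _ => hd z h1.le

theorem circleIntegrable_mul {F φ : ℂ → ℂ} (hφ : Continuous φ) {R : ℝ} (hR : 1 < R)
    (hF : ∀ z, ‖z‖ ≠ 1 → ContinuousAt F z) : CircleIntegrable (fun z => φ z * F z) 0 R := by
  refine ContinuousOn.circleIntegrable (by linarith) fun z hz => ?_
  refine (hφ.continuousAt.mul (hF z ?_)).continuousWithinAt
  rw [mem_sphere_zero_iff_norm.1 hz]
  exact hR.ne'

/-- Integration by parts on a circle. -/
theorem circleIntegral_pow_mul_deriv {F : ℂ → ℂ} (hF : DifferentiableOn ℂ F unitCircleᶜ) (k : ℕ)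
    {R : ℝ} (hR : 1 < R) :
    (∮ z in C(0, R), z ^ (k + 1) * deriv F z) = -(k + 1) * ∮ z in C(0, R), z ^ k * F z := by
  have h0 : (∮ z in C(0, R), ((k + 1 : ℂ) * (z ^ k * F z) + z ^ (k + 1) * deriv F z)) = 0 := by
    refine circleIntegral.integral_eq_zero_of_hasDerivWithinAt (f := fun z => z ^ (k + 1) * F z)
      (by linarith) fun z hz => ?_
    have hF' := (analyticAt_of_norm_ne_one hF (z := z)
      (by rw [mem_sphere_zero_iff_norm.1 hz]; exact hR.ne')).differentiableAt.hasDerivAt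
    have h1 : HasDerivWithinAt (fun z => z ^ (k + 1) * F z) _ (Metric.sphere 0 R) z :=
      ((hasDerivAt_pow (k + 1) z).mul hF').hasDerivWithinAt
    refine h1.congr_deriv ?_
    push_cast [Nat.add_sub_cancel]
    ring
  have hi1 : CircleIntegrable (fun z => z ^ k * F z) 0 R := circleIntegrable_mul (continuous_pow k)
    hR fun z hz => (analyticAt_of_norm_ne_one hF hz).continuousAt
  have hi2 : CircleIntegrable (fun z => z ^ (k + 1) * deriv F z) 0 R :=
    circleIntegrable_mul (continuous_pow (k + 1)) hR
      fun z hz => (analyticAt_of_norm_ne_one hF hz).deriv.continuousAt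
  have hi3 : CircleIntegrable (fun z => (k + 1 : ℂ) * (z ^ k * F z)) 0 R := by
    simpa only [smul_eq_mul] using hi1.const_fun_smul (a := (k + 1 : ℂ))
  rw [circleIntegral.integral_add hi3 hi2,
    circleIntegral.integral_const_mul] at h0
  linear_combination h0

/-! ### Boundedness of the pairing in the Bloch norm -/

theorem ofPolynomial_apply (Q : Polynomial ℂ) {z : ℂ} (hz : z ∈ disc) :
    (LittleBloch.ofPolynomial Q : ℂ → ℂ) z = Q.eval z := by
  change disc.indicator (fun z => Q.eval z) z = Q.eval z
  exact indicator_of_mem hz _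

theorem one_sub_norm_mul_eval_derivative_le (Q : Polynomial ℂ) {w : ℂ} (hw : ‖w‖ < 1) :
    (1 - ‖w‖) * ‖Q.derivative.eval w‖ ≤ ‖LittleBloch.ofPolynomial Q‖ := by
  have hw' : w ∈ disc := mem_ball_zero_iff.2 hw
  have hd : deriv (LittleBloch.ofPolynomial Q : ℂ → ℂ) w = Q.derivative.eval w := by
    have heq : (LittleBloch.ofPolynomial Q : ℂ → ℂ) =ᶠ[𝓝 w] fun z => Q.eval z :=
      EqOn.eventuallyEq_of_mem (s := disc) (fun z hz => ofPolynomial_apply Q hz)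
        (Metric.isOpen_ball.mem_nhds hw')
    rw [heq.deriv_eq, Q.deriv]
  have h1 := le_ciSup (LittleBloch.bddAbove_weightedDeriv (LittleBloch.ofPolynomial Q)) ⟨w, hw'⟩
  rw [LittleBloch.weightedDeriv, hd] at h1
  exact h1.trans (le_add_of_nonneg_left (norm_nonneg _))

theorem norm_eval_zero_le (Q : Polynomial ℂ) :
    ‖Q.eval 0‖ ≤ ‖LittleBloch.ofPolynomial Q‖ := by
  have h1 : (LittleBloch.ofPolynomial Q : ℂ → ℂ) 0 = Q.eval 0 :=
    ofPolynomial_apply Q (Metric.mem_ball_self one_pos)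
  have h2 : 0 ≤ ⨆ z : disc, LittleBloch.weightedDeriv (LittleBloch.ofPolynomial Q) z :=
    Real.iSup_nonneg (LittleBloch.weightedDeriv_nonneg _)
  rw [← h1]
  exact le_add_of_nonneg_right h2

/-- The weight `2 (1 - R⁻²) / R` on `(1, ∞)`. It satisfies
`∫ R^(-2k) k (k + 1) w(R) dR = 1` for every `k ≥ 1`. -/
noncomputable def radialWeight (R : ℝ) : ℝ := 2 * (1 - (R ^ 2)⁻¹) * R⁻¹

theorem radialWeight_integral (k : ℕ) (hk : k ≠ 0) :
    IntegrableOn (fun R : ℝ => radialWeight R * (R ^ (2 * k))⁻¹) (Ioi 1) ∧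
      ∫ R in Ioi (1 : ℝ), radialWeight R * (R ^ (2 * k))⁻¹ = ((k : ℝ) * (k + 1))⁻¹ := by
  have hk0 : (0 : ℝ) < k := by exact_mod_cast Nat.pos_of_ne_zero hk
  have e : EqOn (fun R : ℝ => radialWeight R * (R ^ (2 * k))⁻¹)
      (fun R : ℝ => 2 * R ^ (-(2 * k + 1) : ℝ) - 2 * R ^ (-(2 * k + 3) : ℝ)) (Ioi 1) := by
    intro R hR
    have hR0 : (0 : ℝ) < R := one_pos.trans hR
    have h1 : R ^ (-(2 * k + 1) : ℝ) = (R ^ (2 * k + 1))⁻¹ := by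
      rw [Real.rpow_neg hR0.le]
      exact_mod_cast congrArg (·⁻¹) (Real.rpow_natCast R (2 * k + 1))
    have h2 : R ^ (-(2 * k + 3) : ℝ) = (R ^ (2 * k + 3))⁻¹ := by
      rw [Real.rpow_neg hR0.le]
      exact_mod_cast congrArg (·⁻¹) (Real.rpow_natCast R (2 * k + 3))
    simp only [radialWeight, h1, h2]
    field_simp
    ring
  have i1 : IntegrableOn (fun R : ℝ => R ^ (-(2 * k + 1) : ℝ)) (Ioi 1) :=
    integrableOn_Ioi_rpow_of_lt (by linarith) one_pos
  have i2 : IntegrableOn (fun R : ℝ => R ^ (-(2 * k + 3) : ℝ)) (Ioi 1) :=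
    integrableOn_Ioi_rpow_of_lt (by linarith) one_pos
  refine ⟨IntegrableOn.congr_fun ((i1.const_mul 2).sub (i2.const_mul 2)) e.symm measurableSet_Ioi,
    ?_⟩
  rw [setIntegral_congr_fun measurableSet_Ioi e, integral_sub (i1.const_mul 2) (i2.const_mul 2),
    integral_const_mul, integral_const_mul, integral_Ioi_rpow_of_lt (by linarith) one_pos,
    integral_Ioi_rpow_of_lt (by linarith) one_pos, Real.one_rpow, Real.one_rpow]
  have h1 : (-(2 * k + 1) : ℝ) + 1 = -(2 * k) := by ring
  have h2 : (-(2 * k + 3) : ℝ) + 1 = -(2 * (k + 1)) := by ring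
  rw [h1, h2]
  field_simp
  ring

/-- The integral over `|z| = R` of `F'(z)` against the derivative of `Q` at the reflected point
`1 / conj z = z / R²`. -/
noncomputable def reflectedPairing (F : ℂ → ℂ) (Q : Polynomial ℂ) (R : ℝ) : ℂ :=
  ∮ z in C(0, R), (z * (Polynomial.X * Q.derivative).eval (z / (R : ℂ) ^ 2)) * deriv F z

theorem reflectedPairing_add {F : ℂ → ℂ} (hF : DifferentiableOn ℂ F unitCircleᶜ)
    (P Q : Polynomial ℂ) {R : ℝ} (hR : 1 < R) :
    reflectedPairing F (P + Q) R = reflectedPairing F P R + reflectedPairing F Q R := by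
  unfold reflectedPairing
  have hi : ∀ P : Polynomial ℂ, CircleIntegrable (fun z =>
      (z * (Polynomial.X * P.derivative).eval (z / (R : ℂ) ^ 2)) * deriv F z) 0 R := fun P =>
    circleIntegrable_mul (continuous_id.mul ((Polynomial.continuous _).comp
      (continuous_id.div_const _))) hR
        fun z hz => (analyticAt_of_norm_ne_one hF hz).deriv.continuousAt
  rw [← circleIntegral.integral_add (hi P) (hi Q)]
  congr 1
  ext z
  simp only [Polynomial.derivative_add, mul_add, Polynomial.eval_add, add_mul]

theorem reflectedPairing_monomial {F : ℂ → ℂ} (hF : DifferentiableOn ℂ F unitCircleᶜ)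
    (k : ℕ) (c : ℂ) {R : ℝ} (hR : 1 < R) :
    reflectedPairing F (Polynomial.monomial k c) R =
      -(c * k * (k + 1) * ∮ z in C(0, 2), z ^ k * F z) * ((R ^ (2 * k))⁻¹ : ℝ) := by
  unfold reflectedPairing
  have e : ∀ z : ℂ, (z * (Polynomial.X * (Polynomial.monomial k c).derivative).eval
      (z / (R : ℂ) ^ 2)) * deriv F z =
      (c * k * ((R : ℂ) ^ (2 * k))⁻¹) * (z ^ (k + 1) * deriv F z) := by
    intro z
    rcases k with _ | k
    · simp
    · simp only [Polynomial.derivative_monomial, Polynomial.eval_mul, Polynomial.eval_X,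
        Polynomial.eval_monomial, Nat.add_sub_cancel, div_eq_mul_inv]
      rw [show 2 * (k + 1) = 2 + 2 * k by ring, pow_add (R : ℂ), mul_inv]
      ring
  simp only [e]
  rw [circleIntegral.integral_const_mul, circleIntegral_pow_mul_deriv hF k hR,
    circleIntegral_pow_mul_eq hF k one_lt_two hR]
  push_cast
  ring

/-- A Littlewood–Paley type identity: up to the constant coefficient of `Q`, the integral of `Q F`
over a circle is an area integral of `F'` against `Q'` at the reflected point. -/
theorem integral_radialWeight_mul_reflectedPairing {F : ℂ → ℂ}
    (hF : DifferentiableOn ℂ F unitCircleᶜ) (Q : Polynomial ℂ) :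
    IntegrableOn (fun R : ℝ => (radialWeight R : ℂ) * reflectedPairing F Q R) (Ioi 1) ∧
      ∫ R in Ioi (1 : ℝ), (radialWeight R : ℂ) * reflectedPairing F Q R =
        Q.eval 0 * (∮ z in C(0, 2), F z) - ∮ z in C(0, 2), Q.eval z * F z := by
  induction Q using Polynomial.induction_on' with
  | add P Q hP hQ =>
    have e : EqOn (fun R : ℝ => (radialWeight R : ℂ) * reflectedPairing F (P + Q) R)
        (fun R : ℝ => (radialWeight R : ℂ) * reflectedPairing F P R +
          (radialWeight R : ℂ) * reflectedPairing F Q R) (Ioi 1) := fun R hR => by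
      simp only [reflectedPairing_add hF P Q hR, mul_add]
    refine ⟨IntegrableOn.congr_fun (hP.1.add hQ.1) e.symm measurableSet_Ioi, ?_⟩
    have hi : ∀ P : Polynomial ℂ, CircleIntegrable (fun z => P.eval z * F z) 0 2 := fun P =>
      circleIntegrable_mul P.continuous one_lt_two
        fun z hz => (analyticAt_of_norm_ne_one hF hz).continuousAt
    rw [setIntegral_congr_fun measurableSet_Ioi e, integral_add hP.1 hQ.1, hP.2, hQ.2]
    simp only [Polynomial.eval_add, add_mul]
    rw [circleIntegral.integral_add (hi P) (hi Q)]
    ring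
  | monomial k c =>
    have e : EqOn (fun R : ℝ => (radialWeight R : ℂ) *
        reflectedPairing F (Polynomial.monomial k c) R)
        (fun R : ℝ => -(c * k * (k + 1) * ∮ z in C(0, 2), z ^ k * F z) *
          ((radialWeight R * (R ^ (2 * k))⁻¹ : ℝ) : ℂ)) (Ioi 1) := fun R hR => by
      simp only [reflectedPairing_monomial hF k c hR]
      push_cast
      ring
    have e2 : (∮ z in C(0, 2), (Polynomial.monomial k c).eval z * F z) =
        c * ∮ z in C(0, 2), z ^ k * F z := by
      simp only [Polynomial.eval_monomial, mul_assoc]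
      rw [circleIntegral.integral_const_mul]
    rcases eq_or_ne k 0 with rfl | hk
    · have e3 : EqOn (fun R : ℝ => (radialWeight R : ℂ) *
          reflectedPairing F (Polynomial.monomial 0 c) R) (fun _ => 0) (Ioi 1) :=
        fun R hR => by simpa using e hR
      refine ⟨IntegrableOn.congr_fun integrableOn_zero e3.symm measurableSet_Ioi, ?_⟩
      rw [setIntegral_congr_fun measurableSet_Ioi e3, e2]
      simp
    · obtain ⟨h1, h2⟩ := radialWeight_integral k hk
      refine ⟨IntegrableOn.congr_fun (h1.ofReal.const_mul _) e.symm measurableSet_Ioi, ?_⟩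
      rw [setIntegral_congr_fun measurableSet_Ioi e, integral_const_mul, integral_complex_ofReal, h2, e2]
      have hk0 : (k : ℂ) ≠ 0 := by exact_mod_cast hk
      have hk1 : (k : ℂ) + 1 ≠ 0 := by exact_mod_cast k.succ_ne_zero
      simp only [Polynomial.eval_monomial, zero_pow hk]
      push_cast
      field_simp
      ring

theorem norm_radialWeight_mul_reflectedPairing_le {F : ℂ → ℂ}
    (hF : DifferentiableOn ℂ F unitCircleᶜ) (Q : Polynomial ℂ) {R : ℝ} (hR : 1 < R) :
    ‖(radialWeight R : ℂ) * reflectedPairing F Q R‖ ≤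
      4 * ‖LittleBloch.ofPolynomial Q‖ *
        ∫ θ in Ioc 0 (2 * Real.pi), ‖deriv F (circleMap 0 R θ)‖ := by
  have hR0 : 0 < R := one_pos.trans hR
  have hR1 : R⁻¹ < 1 := inv_lt_one_of_one_lt₀ hR
  have hw : radialWeight R ≤ 4 * (1 - R⁻¹) * R⁻¹ := by
    unfold radialWeight
    refine mul_le_mul_of_nonneg_right ?_ (inv_nonneg.2 hR0.le)
    rw [← inv_pow]
    nlinarith [inv_pos.2 hR0]
  have hw0 : 0 ≤ radialWeight R := by
    unfold radialWeight
    have : (R ^ 2)⁻¹ ≤ 1 := inv_le_one_of_one_le₀ (one_le_pow₀ hR.le)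
    have := inv_nonneg.2 hR0.le
    refine mul_nonneg (mul_nonneg zero_le_two (by linarith)) this
  have hcont : Continuous fun θ => deriv F (circleMap 0 R θ) :=
    continuous_iff_continuousAt.2 fun θ => ContinuousAt.comp (f := circleMap 0 R)
      (analyticAt_of_norm_ne_one hF
        (by rw [norm_circleMap_of_nonneg hR0.le]; exact hR.ne')).deriv.continuousAt
      (continuous_circleMap 0 R).continuousAt
  rw [norm_mul, Complex.norm_real, Real.norm_of_nonneg hw0, reflectedPairing, circleIntegral,
    intervalIntegral.integral_of_le Real.two_pi_pos.le, ← integral_const_mul]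
  refine (mul_le_mul_of_nonneg_left (norm_integral_le_integral_norm _) hw0).trans ?_
  rw [← integral_const_mul]
  refine integral_mono_of_nonneg (Eventually.of_forall fun θ => mul_nonneg hw0 (norm_nonneg _))
    ((hcont.norm.const_mul _).integrableOn_Ioc) (Eventually.of_forall fun θ => ?_)
  have hn : ‖circleMap 0 R θ / (R : ℂ) ^ 2‖ = R⁻¹ := by
    rw [norm_div, norm_circleMap_of_nonneg hR0.le, norm_pow, Complex.norm_real,
      Real.norm_of_nonneg hR0.le]
    field_simp
  have hQ := one_sub_norm_mul_eval_derivative_le Q (hn.trans_lt hR1)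
  rw [hn] at hQ
  set q := ‖Q.derivative.eval (circleMap 0 R θ / (R : ℂ) ^ 2)‖ with hq
  have hq0 : 0 ≤ q := norm_nonneg _
  have hnorm : ‖deriv (circleMap 0 R) θ • (circleMap 0 R θ * (Polynomial.X *
      Q.derivative).eval (circleMap 0 R θ / (R : ℂ) ^ 2) * deriv F (circleMap 0 R θ))‖ =
      R * q * ‖deriv F (circleMap 0 R θ)‖ := by
    rw [deriv_circleMap, norm_smul, norm_mul, Complex.norm_I, norm_mul, norm_mul,
      Polynomial.eval_mul, Polynomial.eval_X, norm_mul, hn, norm_circleMap_of_nonneg hR0.le, ← hq]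
    field_simp
  simp only [hnorm]
  rw [← mul_assoc]
  refine mul_le_mul_of_nonneg_right ?_ (norm_nonneg _)
  calc radialWeight R * (R * q) ≤ 4 * (1 - R⁻¹) * R⁻¹ * (R * q) := by gcongr
    _ = 4 * ((1 - R⁻¹) * q) := by field_simp
    _ ≤ _ := by gcongr

/-- If `F'` is integrable, then `Q ↦ ∮ Q F` is bounded in the Bloch norm. -/
theorem exists_norm_circleIntegral_le {F : ℂ → ℂ} (hF : DifferentiableOn ℂ F unitCircleᶜ)
    (hI : Integrable (deriv F)) :
    ∃ C, ∀ Q : Polynomial ℂ,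
      ‖∮ z in C(0, 2), Q.eval z * F z‖ ≤ C * ‖LittleBloch.ofPolynomial Q‖ := by
  have hN := (integrable_radial (measurable_deriv F) hI one_pos).integral_norm_prod_left
  refine ⟨‖∮ z in C(0, 2), F z‖ + 4 * ∫ R in Ioi (1 : ℝ),
    ∫ θ in Ioc 0 (2 * Real.pi), ‖deriv F (circleMap 0 R θ)‖, fun Q => ?_⟩
  have h1 := (integral_radialWeight_mul_reflectedPairing hF Q).2
  have h2 : ‖∫ R in Ioi (1 : ℝ), (radialWeight R : ℂ) * reflectedPairing F Q R‖ ≤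
      ∫ R in Ioi (1 : ℝ), 4 * ‖LittleBloch.ofPolynomial Q‖ *
        ∫ θ in Ioc 0 (2 * Real.pi), ‖deriv F (circleMap 0 R θ)‖ := by
    refine norm_integral_le_of_norm_le (hN.const_mul _) ?_
    filter_upwards [ae_restrict_mem measurableSet_Ioi] with R hR
    exact norm_radialWeight_mul_reflectedPairing_le hF Q hR
  rw [integral_const_mul] at h2
  have h3 : (∮ z in C(0, 2), Q.eval z * F z) = Q.eval 0 * (∮ z in C(0, 2), F z) -
      ∫ R in Ioi (1 : ℝ), (radialWeight R : ℂ) * reflectedPairing F Q R := by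
    rw [h1]
    ring
  rw [h3]
  have h4 := mul_le_mul_of_nonneg_right (norm_eval_zero_le Q) (norm_nonneg (∮ z in C(0, 2), F z))
  rw [← norm_mul] at h4
  exact (norm_sub_le _ _).trans ((add_le_add h4 h2).trans (le_of_eq (by ring)))

/-! ### Simultaneous approximation and annihilating functionals -/

/-- If `E` has the SA-property, a function in `L¹(E)` whose pairing with polynomials is bounded in
the Bloch norm annihilates `L^∞(E)`: the inequality `|⟨g, h⟩| ≤ C ‖f‖` defines a closed set of pairs
`(f, g)` that contains all `(Q, Q)`, hence it holds for all pairs `(0, g)`. -/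
theorem HasSAProperty.pairing_eq_zero {E : Set ℂ} (hSA : HasSAProperty E)
    (h : Lp ℂ 1 (circleMeasure.restrict E)) {C : ℝ}
    (hC : ∀ Q : Polynomial ℂ, ‖(WeakStarLinfty.ofPolynomial E Q).pairing h‖ ≤
      C * ‖LittleBloch.ofPolynomial Q‖) (g : WeakStarLinfty E) : g.pairing h = 0 := by
  have hcont : Continuous fun g : WeakStarLinfty E => g.pairing h :=
    (continuous_apply h).comp
      (continuous_induced_dom : Continuous (WeakStarLinfty.pairing (E := E)))
  have hclosed : IsClosed {p : LittleBloch × WeakStarLinfty E | ‖p.2.pairing h‖ ≤ C * ‖p.1‖} :=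
    isClosed_le (hcont.comp continuous_snd).norm (continuous_fst.norm.const_mul C)
  have hsub : simultaneousClosure E ⊆
      {p : LittleBloch × WeakStarLinfty E | ‖p.2.pairing h‖ ≤ C * ‖p.1‖} := by
    refine closure_minimal ?_ hclosed
    rintro _ ⟨Q, rfl⟩
    exact hC Q
  have h0 : ((0 : LittleBloch), g) ∈ simultaneousClosure E := by
    rw [HasSAProperty] at hSA
    rw [hSA]
    exact mem_univ _
  have h1 : ‖g.pairing h‖ ≤ C * ‖(0 : LittleBloch)‖ := hsub h0
  rw [norm_zero, mul_zero] at h1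
  exact norm_le_zero_iff.1 h1

theorem HasSAProperty.ae_eq_zero {E : Set ℂ} (hSA : HasSAProperty E) {k : ℂ → ℂ}
    (hk : Integrable k (circleMeasure.restrict E)) {C : ℝ}
    (hC : ∀ Q : Polynomial ℂ, ‖∫ ζ in E, Q.eval ζ * k ζ ∂circleMeasure‖ ≤
      C * ‖LittleBloch.ofPolynomial Q‖) : k =ᵐ[circleMeasure.restrict E] 0 := by
  have hL : MemLp k 1 (circleMeasure.restrict E) := memLp_one_iff_integrable.2 hk
  have hpair : ∀ {u : ℂ → ℂ} (hu : MemLp u ∞ (circleMeasure.restrict E)),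
      WeakStarLinfty.pairing (E := E) (hu.toLp u) (hL.toLp k) =
        ∫ ζ in E, u ζ * k ζ ∂circleMeasure := by
    intro u hu
    refine integral_congr_ae ?_
    filter_upwards [hu.coeFn_toLp, hL.coeFn_toLp] with ζ h1 h2
    exact congrArg₂ (· * ·) h1 h2
  have hz := hSA.pairing_eq_zero (hL.toLp k) (C := C) fun Q => by
    have := hpair (WeakStarLinfty.memLp_polynomial E Q)
    exact (congrArg norm this).trans_le (hC Q)
  refine hk.ae_eq_zero_of_forall_setIntegral_eq_zero fun s hs _ => ?_
  have hu : MemLp (s.indicator fun _ : ℂ => (1 : ℂ)) ∞ (circleMeasure.restrict E) :=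
    (memLp_const 1).indicator hs
  rw [← integral_indicator hs, ← hz (hu.toLp _), hpair hu]
  congr 1
  ext ζ
  by_cases hζ : ζ ∈ s <;> simp [hζ]

/-! ### The jump across the circle -/

theorem map_circleMap_absolutelyContinuous :
    (volume.restrict (Ioc 0 (2 * Real.pi))).map (circleMap 0 1) ≪ circleMeasure :=
  Measure.absolutelyContinuous_smul (ENNReal.ofReal_pos.2 (inv_pos.2 Real.two_pi_pos)).ne'

theorem integrable_circleMeasure {f : ℂ → ℂ} (hf : AEStronglyMeasurable f circleMeasure)
    (hi : Integrable (fun θ => f (circleMap 0 1 θ)) (volume.restrict (Ioc 0 (2 * Real.pi)))) :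
    Integrable f circleMeasure := by
  have hf' := hf.mono_ac map_circleMap_absolutelyContinuous
  exact ((integrable_map_measure hf' (continuous_circleMap 0 1).aemeasurable).2 hi).smul_measure
    ENNReal.ofReal_ne_top

theorem integral_circleMeasure {f : ℂ → ℂ} (hf : AEStronglyMeasurable f circleMeasure) :
    ∫ ζ, f ζ ∂circleMeasure =
      (2 * Real.pi)⁻¹ • ∫ θ in Ioc 0 (2 * Real.pi), f (circleMap 0 1 θ) := by
  have hf' := hf.mono_ac map_circleMap_absolutelyContinuous
  rw [circleMeasure, integral_smul_measure,
    integral_map (continuous_circleMap 0 1).aemeasurable hf',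
    ENNReal.toReal_ofReal (inv_nonneg.2 Real.two_pi_pos.le)]

theorem integral_circleMeasure_mul_id {f : ℂ → ℂ} (hf : AEStronglyMeasurable f circleMeasure) :
    ∫ ζ, f ζ * ζ ∂circleMeasure = (2 * Real.pi * Complex.I)⁻¹ * ∮ z in C(0, 1), f z := by
  have hm : AEStronglyMeasurable (fun ζ => f ζ * ζ) circleMeasure :=
    hf.mul continuous_id.aestronglyMeasurable
  rw [integral_circleMeasure hm, circleIntegral,
    intervalIntegral.integral_of_le Real.two_pi_pos.le]
  simp only [deriv_circleMap, smul_eq_mul]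
  have : ∀ θ, circleMap 0 1 θ * Complex.I * f (circleMap 0 1 θ) =
      Complex.I * (f (circleMap 0 1 θ) * circleMap 0 1 θ) := fun θ => by ring
  simp only [this]
  have hI : (2 * Real.pi * Complex.I : ℂ)⁻¹ * Complex.I = ((2 * Real.pi)⁻¹ : ℝ) := by
    push_cast
    rw [mul_inv, mul_assoc, inv_mul_cancel₀ Complex.I_ne_zero, mul_one]
  rw [integral_const_mul, ← mul_assoc, hI, Complex.real_smul]

theorem ae_circleMap_of_ae_circleMeasure {p : ℂ → Prop} (h : ∀ᵐ ζ ∂circleMeasure, p ζ) :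
    ∀ᵐ θ ∂volume.restrict (Ioc 0 (2 * Real.pi)), p (circleMap 0 1 θ) := by
  exact ae_of_ae_map (continuous_circleMap 0 1).aemeasurable
    (map_circleMap_absolutelyContinuous.ae_le h)

theorem aestronglyMeasurable_comp_mul {F : ℂ → ℂ} (hF : DifferentiableOn ℂ F unitCircleᶜ) {r : ℝ}
    (hr : 0 ≤ r) (hr1 : r ≠ 1) :
    AEStronglyMeasurable (fun ζ => F (r * ζ)) circleMeasure := by
  have hc : ContinuousOn (fun ζ => F (r * ζ)) unitCircle := fun ζ hζ => by
    refine (ContinuousAt.comp (f := fun ζ : ℂ => (r : ℂ) * ζ)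
      (analyticAt_of_norm_ne_one hF ?_).continuousAt (by fun_prop)).continuousWithinAt
    rwa [norm_mul, mem_sphere_zero_iff_norm.1 hζ, mul_one, Complex.norm_real,
      Real.norm_of_nonneg hr]
  have := hc.aestronglyMeasurable (μ := circleMeasure) Metric.isClosed_sphere.measurableSet
  rwa [Measure.restrict_eq_self_of_ae_mem ae_mem_unitCircle] at this

theorem stronglyMeasurable_integral_ray {f : ℂ → ℂ} (hf : Measurable f) {a b : ℝ} (hab : a ≤ b) :
    StronglyMeasurable fun ζ : ℂ => ∫ s in a..b, f (s * ζ) := by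
  simp only [intervalIntegral.integral_of_le hab]
  have hm : Measurable fun p : ℂ × ℝ => f (p.2 * p.1) := hf.comp (by fun_prop)
  exact hm.stronglyMeasurable.integral_prod_right'

theorem aestronglyMeasurable_interiorTrace {F : ℂ → ℂ} (hF : DifferentiableOn ℂ F unitCircleᶜ) :
    AEStronglyMeasurable (interiorTrace F) circleMeasure :=
  (aestronglyMeasurable_comp_mul hF (by norm_num) (by norm_num)).add
    (continuous_id.aestronglyMeasurable.mul (stronglyMeasurable_integral_ray (measurable_deriv F)
      (by norm_num)).aestronglyMeasurable)

theorem aestronglyMeasurable_exteriorTrace {F : ℂ → ℂ} (hF : DifferentiableOn ℂ F unitCircleᶜ) :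
    AEStronglyMeasurable (exteriorTrace F) circleMeasure :=
  (aestronglyMeasurable_comp_mul hF (by norm_num) (by norm_num)).sub
    (continuous_id.aestronglyMeasurable.mul (stronglyMeasurable_integral_ray (measurable_deriv F)
      (by norm_num)).aestronglyMeasurable)

theorem integrable_interiorTrace {F : ℂ → ℂ} (hF : DifferentiableOn ℂ F unitCircleᶜ)
    (hI : Integrable (deriv F)) : Integrable (interiorTrace F) circleMeasure := by
  obtain ⟨B, hB, hBd⟩ := exists_integrable_majorant hF hI
  have hm := aestronglyMeasurable_interiorTrace hF
  have hm' := (hm.mono_ac map_circleMap_absolutelyContinuous).comp_aemeasurable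
    (continuous_circleMap 0 1).aemeasurable
  refine integrable_circleMeasure hm (hB.mono' hm' ?_)
  filter_upwards [ae_integrableOn_ray (measurable_deriv F) hI, hBd] with θ hθ hb
  refine le_of_tendsto (tendsto_interiorTrace hF hθ).norm ?_
  filter_upwards [Ioo_mem_nhdsLT (by norm_num : (1 / 2 : ℝ) < 1)] with r hr
  exact hb r hr.1.le hr.2.ne

theorem integrable_exteriorTrace {F : ℂ → ℂ} (hF : DifferentiableOn ℂ F unitCircleᶜ)
    (hI : Integrable (deriv F)) : Integrable (exteriorTrace F) circleMeasure := by
  obtain ⟨B, hB, hBd⟩ := exists_integrable_majorant hF hI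
  have hm := aestronglyMeasurable_exteriorTrace hF
  have hm' := (hm.mono_ac map_circleMap_absolutelyContinuous).comp_aemeasurable
    (continuous_circleMap 0 1).aemeasurable
  refine integrable_circleMeasure hm (hB.mono' hm' ?_)
  filter_upwards [ae_integrableOn_ray (measurable_deriv F) hI, hBd] with θ hθ hb
  refine le_of_tendsto (tendsto_exteriorTrace hF hθ).norm ?_
  filter_upwards [Ioo_mem_nhdsGT (by norm_num : (1 : ℝ) < 2)] with r hr
  have h1 : 1 < r := hr.1
  exact hb r (by linarith) h1.ne'

/-- There is no jump across an arc through which `F` is holomorphic. -/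
theorem interiorTrace_eq_exteriorTrace {F : ℂ → ℂ} (hF : DifferentiableOn ℂ F unitCircleᶜ)
    {ζ : ℂ} (hζ : ζ ∈ unitCircle) (h : AnalyticAt ℂ F ζ) :
    interiorTrace F ζ = exteriorTrace F ζ := by
  have ha : ∀ s : ℝ, 0 ≤ s → AnalyticAt ℂ F (s * ζ) := by
    intro s hs
    rcases eq_or_ne s 1 with rfl | h1
    · simpa using h
    · refine analyticAt_of_norm_ne_one hF ?_
      rwa [norm_mul, mem_sphere_zero_iff_norm.1 hζ, mul_one, Complex.norm_real,
        Real.norm_of_nonneg hs]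
  have h1 := sub_eq_mul_integral_deriv (F := F) (ζ := ζ) (a := 1 / 2) (b := 1) fun s hs =>
    ha s (le_trans (by norm_num) hs.1)
  have h2 := sub_eq_mul_integral_deriv (F := F) (ζ := ζ) (a := 1) (b := 2) fun s hs =>
    ha s (le_trans (by norm_num) hs.1)
  rw [interiorTrace, exteriorTrace, ← h1, ← h2]
  ring

/-- The polynomial moments of the jump are contour integrals of `F` in the exterior domain. -/
theorem integral_eval_mul_jump {F : ℂ → ℂ} (hF : DifferentiableOn ℂ F unitCircleᶜ)
    (hI : Integrable (deriv F)) (Q : Polynomial ℂ) :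
    ∫ ζ, Q.eval ζ * (interiorTrace F ζ - exteriorTrace F ζ) * ζ ∂circleMeasure =
      -((2 * Real.pi * Complex.I)⁻¹ * ∮ z in C(0, 2), Q.eval z * F z) := by
  have hQ : AEStronglyMeasurable (fun ζ => Q.eval ζ) circleMeasure :=
    Q.continuous.aestronglyMeasurable
  have hbd : ∃ C, ∀ᵐ ζ ∂circleMeasure, ‖Q.eval ζ * ζ‖ ≤ C := by
    obtain ⟨C, hC⟩ := (isCompact_sphere (0 : ℂ) 1).exists_bound_of_continuousOn
      (f := fun z => Q.eval z * z) (Q.continuous.mul continuous_id).continuousOn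
    exact ⟨C, ae_mem_unitCircle.mono hC⟩
  obtain ⟨C, hC⟩ := hbd
  have hi : ∀ {T : ℂ → ℂ}, Integrable T circleMeasure →
      Integrable (fun ζ => Q.eval ζ * T ζ * ζ) circleMeasure := fun {T} hT =>
    (hT.bdd_mul (f := fun ζ => Q.eval ζ * ζ) (hQ.mul continuous_id.aestronglyMeasurable)
      hC).congr (Eventually.of_forall fun ζ => by simp only; ring)
  have h1 := integrable_interiorTrace hF hI
  have h2 := integrable_exteriorTrace hF hI
  have hsplit : ∀ ζ, Q.eval ζ * (interiorTrace F ζ - exteriorTrace F ζ) * ζ =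
      Q.eval ζ * interiorTrace F ζ * ζ - Q.eval ζ * exteriorTrace F ζ * ζ := fun ζ => by ring
  simp only [hsplit]
  have hin : (∮ z in C(0, 1), Q.eval z * interiorTrace F z) = 0 := by
    refine tendsto_nhds_unique (tendsto_circleIntegral_interiorTrace (φ := fun z => Q.eval z) hF hI
      (zero_lt_one) Q.continuous.continuousOn) (tendsto_const_nhds.congr' ?_)
    filter_upwards [Ioo_mem_nhdsLT (zero_lt_one (α := ℝ))] with r hr
    have hd : ∀ z ∈ Metric.closedBall (0 : ℂ) r, DifferentiableAt ℂ (fun z => Q.eval z * F z) z :=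
      fun z hz => Q.differentiableAt.mul (analyticAt_of_norm_ne_one hF
        ((mem_closedBall_zero_iff.1 hz).trans_lt hr.2).ne).differentiableAt
    exact (Complex.circleIntegral_eq_zero_of_differentiable_on_off_countable hr.1.le
      countable_empty (fun z hz => (hd z hz).continuousAt.continuousWithinAt)
      fun z hz => hd z (Metric.ball_subset_closedBall hz.1)).symm
  have hm1 : AEStronglyMeasurable (fun ζ => Q.eval ζ * interiorTrace F ζ) circleMeasure :=
    hQ.mul h1.1
  have hm2 : AEStronglyMeasurable (fun ζ => Q.eval ζ * exteriorTrace F ζ) circleMeasure :=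
    hQ.mul h2.1
  rw [integral_sub (hi h1) (hi h2), integral_circleMeasure_mul_id hm1,
    integral_circleMeasure_mul_id hm2, hin,
    circleIntegral_eq_exteriorTrace (φ := fun z => Q.eval z) (b := 2) hF hI
      (fun z _ _ => Q.differentiableAt) one_lt_two le_rfl, mul_zero, zero_sub]

/-- If the compact set `K` has the SA-property, then functions in `W¹_a(ℂ \ K)` have equal boundary
values from both sides of the circle. -/
theorem HasSAProperty.ae_interiorTrace_eq_exteriorTrace {K : Set ℂ} (hSA : HasSAProperty K)
    (hK : IsClosed K) {F : ℂ → ℂ} (hFK : DifferentiableOn ℂ F Kᶜ)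
    (hF : DifferentiableOn ℂ F unitCircleᶜ) (hI : Integrable (deriv F)) :
    ∀ᵐ ζ ∂circleMeasure, interiorTrace F ζ = exteriorTrace F ζ := by
  have hoff : ∀ᵐ ζ ∂circleMeasure, ζ ∉ K → interiorTrace F ζ = exteriorTrace F ζ := by
    filter_upwards [ae_mem_unitCircle] with ζ hζ hζK
    exact interiorTrace_eq_exteriorTrace hF hζ (hFK.analyticAt (hK.isOpen_compl.mem_nhds hζK))
  set k : ℂ → ℂ := fun ζ => (interiorTrace F ζ - exteriorTrace F ζ) * ζ with hk
  have hki : Integrable k circleMeasure := by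
    have hb : ∀ᵐ ζ : ℂ ∂circleMeasure, ‖ζ‖ ≤ 1 :=
      ae_mem_unitCircle.mono fun ζ hζ => (mem_sphere_zero_iff_norm.1 hζ).le
    exact (((integrable_interiorTrace hF hI).sub (integrable_exteriorTrace hF hI)).bdd_mul
      (f := fun ζ : ℂ => ζ) continuous_id.aestronglyMeasurable hb).congr
      (Eventually.of_forall fun ζ => mul_comm _ _)
  obtain ⟨C, hC⟩ := exists_norm_circleIntegral_le hF hI
  have hk0 : k =ᵐ[circleMeasure.restrict K] 0 := by
    refine hSA.ae_eq_zero hki.restrict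
      (C := ‖(2 * Real.pi * Complex.I : ℂ)⁻¹‖ * C) fun Q => ?_
    rw [setIntegral_eq_integral_of_ae_compl_eq_zero]
    · simp only [hk, ← mul_assoc]
      rw [integral_eval_mul_jump hF hI Q, norm_neg, norm_mul]
      exact (mul_le_mul_of_nonneg_left (hC Q) (norm_nonneg _)).trans_eq (mul_assoc _ _ _).symm
    · filter_upwards [hoff] with ζ hζ hζK
      simp [hk, hζ hζK]
  rw [EventuallyEq, ae_restrict_iff' hK.measurableSet] at hk0
  filter_upwards [hk0, hoff, ae_mem_unitCircle] with ζ h1 h2 h3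
  by_cases hζ : ζ ∈ K
  · have hζ0 : ζ ≠ 0 := by
      rintro rfl
      simp at h3
    exact sub_eq_zero.1 ((mul_eq_zero.1 (h1 hζ)).resolve_right hζ0)
  · exact h2 hζ

/-! ### Functions without a jump are constant -/

theorem circleIntegral_interiorTrace_eq_exteriorTrace {F : ℂ → ℂ}
    (hT : ∀ᵐ ζ ∂circleMeasure, interiorTrace F ζ = exteriorTrace F ζ) (φ : ℂ → ℂ) :
    (∮ z in C(0, 1), φ z * interiorTrace F z) = ∮ z in C(0, 1), φ z * exteriorTrace F z := by
  simp only [circleIntegral, intervalIntegral.integral_of_le Real.two_pi_pos.le]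
  refine integral_congr_ae ?_
  filter_upwards [ae_circleMap_of_ae_circleMeasure hT] with θ hθ
  simp only [hθ]

theorem differentiableAt_sub_inv {z w : ℂ} (h : w ≠ z) :
    DifferentiableAt ℂ (fun w => (w - z)⁻¹) w :=
  (differentiableAt_id.sub_const z).inv (sub_ne_zero.2 h)

theorem ne_of_norm_ne {z w : ℂ} (h : ‖w‖ ≠ ‖z‖) : w ≠ z := fun e => h (congrArg norm e)

theorem cauchy_formula_of_norm_lt_one {F : ℂ → ℂ} (hF : DifferentiableOn ℂ F unitCircleᶜ)
    (hI : Integrable (deriv F))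
    (hT : ∀ᵐ ζ ∂circleMeasure, interiorTrace F ζ = exteriorTrace F ζ) {z : ℂ} (hz : ‖z‖ < 1)
    {R : ℝ} (hR : 1 < R) :
    (∮ w in C(0, R), (w - z)⁻¹ * F w) = 2 * Real.pi * Complex.I * F z := by
  rw [circleIntegral_eq_exteriorTrace (φ := fun w => (w - z)⁻¹) (b := R) hF hI
    (fun w h1 _ => differentiableAt_sub_inv (ne_of_norm_ne (hz.trans_le h1).ne')) hR le_rfl,
    ← circleIntegral_interiorTrace_eq_exteriorTrace hT]
  obtain ⟨a, hza, ha⟩ := exists_between hz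
  refine tendsto_nhds_unique (tendsto_circleIntegral_interiorTrace (φ := fun w => (w - z)⁻¹) hF hI
    ha fun w hw => (differentiableAt_sub_inv
      (ne_of_norm_ne (hza.trans_le hw.1).ne')).continuousAt.continuousWithinAt)
      (tendsto_const_nhds.congr' ?_)
  filter_upwards [Ioo_mem_nhdsLT hz] with r hr
  have hd : ∀ w ∈ Metric.closedBall (0 : ℂ) r, DifferentiableAt ℂ F w := fun w hw =>
    (analyticAt_of_norm_ne_one hF ((mem_closedBall_zero_iff.1 hw).trans_lt hr.2).ne).differentiableAt
  have := Complex.circleIntegral_sub_inv_smul_of_differentiable_on_off_countable (f := F)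
    countable_empty (mem_ball_zero_iff.2 hr.1)
    (fun w hw => (hd w hw).continuousAt.continuousWithinAt)
    fun w hw => hd w (Metric.ball_subset_closedBall hw.1)
  simpa only [smul_eq_mul] using this.symm

theorem cauchy_formula_of_one_lt_norm {F : ℂ → ℂ} (hF : DifferentiableOn ℂ F unitCircleᶜ)
    (hI : Integrable (deriv F))
    (hT : ∀ᵐ ζ ∂circleMeasure, interiorTrace F ζ = exteriorTrace F ζ) {z : ℂ} (hz : 1 < ‖z‖)
    {R : ℝ} (hR : ‖z‖ < R) :
    (∮ w in C(0, R), (w - z)⁻¹ * F w) = 2 * Real.pi * Complex.I * F z := by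
  obtain ⟨r, hr, hrz⟩ := exists_between hz
  have hr0 : 0 < r := one_pos.trans hr
  have hzero : (∮ w in C(0, r), (w - z)⁻¹ * F w) = 0 := by
    rw [circleIntegral_eq_exteriorTrace (φ := fun w => (w - z)⁻¹) (b := r) hF hI
      (fun w _ h1 => differentiableAt_sub_inv (ne_of_norm_ne (h1.trans_lt hrz).ne)) hr le_rfl,
      ← circleIntegral_interiorTrace_eq_exteriorTrace hT]
    refine tendsto_nhds_unique (tendsto_circleIntegral_interiorTrace (φ := fun w => (w - z)⁻¹) hF hI
      zero_lt_one fun w hw => (differentiableAt_sub_inv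
        (ne_of_norm_ne (hw.2.trans_lt hz).ne)).continuousAt.continuousWithinAt)
        (tendsto_const_nhds.congr' ?_)
    filter_upwards [Ioo_mem_nhdsLT (zero_lt_one (α := ℝ))] with t ht
    have hd : ∀ w ∈ Metric.closedBall (0 : ℂ) t,
        DifferentiableAt ℂ (fun w => (w - z)⁻¹ * F w) w := fun w hw => by
      have h1 : ‖w‖ < 1 := (mem_closedBall_zero_iff.1 hw).trans_lt ht.2
      exact (differentiableAt_sub_inv (ne_of_norm_ne (h1.trans hz).ne)).mul
        (analyticAt_of_norm_ne_one hF h1.ne).differentiableAt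
    exact (Complex.circleIntegral_eq_zero_of_differentiable_on_off_countable ht.1.le
      countable_empty (fun w hw => (hd w hw).continuousAt.continuousWithinAt)
      fun w hw => hd w (Metric.ball_subset_closedBall hw.1)).symm
  have hzero' : (∮ w in C(0, r), (w - z)⁻¹) = 0 := by
    have hd : ∀ w ∈ Metric.closedBall (0 : ℂ) r, DifferentiableAt ℂ (fun w => (w - z)⁻¹) w :=
      fun w hw => differentiableAt_sub_inv
        (ne_of_norm_ne ((mem_closedBall_zero_iff.1 hw).trans_lt hrz).ne)
    exact Complex.circleIntegral_eq_zero_of_differentiable_on_off_countable hr0.le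
      countable_empty (fun w hw => (hd w hw).continuousAt.continuousWithinAt)
      fun w hw => hd w (Metric.ball_subset_closedBall hw.1)
  -- The divided difference of `F` at `z` has no singularity in the exterior domain.
  have hslope : (∮ w in C(0, R), dslope F z w) = ∮ w in C(0, r), dslope F z w := by
    refine circleIntegral_eq_of_differentiable_annulus hr0 (hrz.trans hR).le
      (countable_singleton z) ?_ ?_
    · intro w h1 _
      have hw := (analyticAt_of_norm_ne_one hF (hr.trans_le h1).ne').differentiableAt
      rcases eq_or_ne w z with rfl | hwz
      · exact continuousAt_dslope_same.2 hw
      · exact (continuousAt_dslope_of_ne hwz).2 hw.continuousAt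
    · intro w hwz h1 _
      exact (differentiableAt_dslope_of_ne hwz).2
        (analyticAt_of_norm_ne_one hF (hr.trans h1).ne').differentiableAt
  have hsplit : ∀ t : ℝ, 1 < t → t ≠ ‖z‖ → (∮ w in C(0, t), dslope F z w) =
      (∮ w in C(0, t), (w - z)⁻¹ * F w) - (∮ w in C(0, t), (w - z)⁻¹) * F z := by
    intro t ht htz
    have ht0 : 0 ≤ t := (one_pos.trans ht).le
    have hne : ∀ w ∈ Metric.sphere (0 : ℂ) t, w ≠ z := fun w hw =>
      ne_of_norm_ne (by rwa [mem_sphere_zero_iff_norm.1 hw])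
    have hinv : ContinuousOn (fun w => (w - z)⁻¹) (Metric.sphere (0 : ℂ) t) := fun w hw =>
      (differentiableAt_sub_inv (hne w hw)).continuousAt.continuousWithinAt
    have hFc : ContinuousOn F (Metric.sphere (0 : ℂ) t) := fun w hw =>
      (analyticAt_of_norm_ne_one hF
        (by rw [mem_sphere_zero_iff_norm.1 hw]; exact ht.ne')).continuousAt.continuousWithinAt
    have hcomm : (∮ w in C(0, t), (w - z)⁻¹) * F z = ∮ w in C(0, t), (w - z)⁻¹ * F z := by
      rw [mul_comm, ← circleIntegral.integral_const_mul]
      simp only [mul_comm]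
    have hi1 : CircleIntegrable (fun w => (w - z)⁻¹ * F w) 0 t :=
      (hinv.mul hFc).circleIntegrable ht0
    have hi2 : CircleIntegrable (fun w => (w - z)⁻¹ * F z) 0 t :=
      (hinv.mul continuousOn_const).circleIntegrable ht0
    rw [hcomm, ← circleIntegral.integral_sub hi1 hi2]
    refine circleIntegral.integral_congr ht0 fun w hw => ?_
    simp only [dslope_of_ne F (hne w hw), slope, vsub_eq_sub, smul_eq_mul]
    ring
  rw [hsplit R (hz.trans hR) hR.ne', hsplit r hr hrz.ne, hzero, hzero',
    circleIntegral.integral_sub_inv_of_mem_ball (mem_ball_zero_iff.2 hR)] at hslope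
  linear_combination hslope

/-- A function holomorphic off the circle, with integrable derivative and no jump, is constant off
the circle: by the Cauchy formula over `|w| = R`, its values at `z` and `0` differ by `O(1/R)`. -/
theorem eq_of_traces_ae_eq {F : ℂ → ℂ} (hF : DifferentiableOn ℂ F unitCircleᶜ)
    (hI : Integrable (deriv F))
    (hT : ∀ᵐ ζ ∂circleMeasure, interiorTrace F ζ = exteriorTrace F ζ) {z : ℂ} (hz : ‖z‖ ≠ 1) :
    F z = F 0 := by
  obtain ⟨B, hB, hBd⟩ := exists_integrable_majorant hF hI
  have hform : ∀ R : ℝ, 1 < R → ‖z‖ < R →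
      (∮ w in C(0, R), (w - z)⁻¹ * F w) = 2 * Real.pi * Complex.I * F z := by
    intro R hR hzR
    rcases lt_or_gt_of_ne hz with h | h
    · exact cauchy_formula_of_norm_lt_one hF hI hT h hR
    · exact cauchy_formula_of_one_lt_norm hF hI hT h hzR
  have hbound : ∀ R : ℝ, 1 < R → ‖z‖ < R → ‖2 * Real.pi * Complex.I * (F z - F 0)‖ ≤
      ‖z‖ / (R - ‖z‖) * ∫ θ in Ioc 0 (2 * Real.pi), B θ := by
    intro R hR hzR
    have hR0 : 0 < R := one_pos.trans hR
    have hFc : ContinuousOn F (Metric.sphere (0 : ℂ) R) := fun w hw =>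
      (analyticAt_of_norm_ne_one hF
        (by rw [mem_sphere_zero_iff_norm.1 hw]; exact hR.ne')).continuousAt.continuousWithinAt
    have hinv : ∀ u : ℂ, ‖u‖ < R →
        CircleIntegrable (fun w => (w - u)⁻¹ * F w) 0 R := fun u hu => by
      refine ContinuousOn.circleIntegrable hR0.le (ContinuousOn.mul (fun w hw => ?_) hFc)
      refine (differentiableAt_sub_inv (ne_of_norm_ne ?_)).continuousAt.continuousWithinAt
      rw [mem_sphere_zero_iff_norm.1 hw]
      exact hu.ne'
    have h0 := cauchy_formula_of_norm_lt_one hF hI hT (z := 0) (by simp) hR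
    rw [mul_sub, ← hform R hR hzR, ← h0, ← circleIntegral.integral_sub (hinv z hzR)
      (hinv 0 (by simpa using hR0)), circleIntegral,
      intervalIntegral.integral_of_le Real.two_pi_pos.le, ← integral_const_mul]
    refine norm_integral_le_of_norm_le (hB.const_mul _) ?_
    filter_upwards [hBd] with θ hθ
    have hθR := hθ R (by linarith) hR.ne'
    have hw : ‖circleMap 0 R θ‖ = R := norm_circleMap_of_nonneg hR0.le
    have hw0 : circleMap 0 R θ ≠ 0 := norm_ne_zero_iff.1 (hw.trans_ne hR0.ne')
    have hwz : circleMap 0 R θ - z ≠ 0 := sub_ne_zero.2 (ne_of_norm_ne (by rw [hw]; exact hzR.ne'))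
    have hle : R - ‖z‖ ≤ ‖circleMap 0 R θ - z‖ := by
      have := norm_sub_norm_le (circleMap 0 R θ) z
      rwa [hw] at this
    have hpos : 0 < R - ‖z‖ := sub_pos.2 hzR
    have heq : deriv (circleMap 0 R) θ • ((circleMap 0 R θ - z)⁻¹ * F (circleMap 0 R θ) -
        (circleMap 0 R θ - 0)⁻¹ * F (circleMap 0 R θ)) =
        Complex.I * (z / (circleMap 0 R θ - z)) * F (circleMap 0 R θ) := by
      rw [deriv_circleMap, smul_eq_mul, sub_zero]
      field_simp
      ring
    rw [heq, norm_mul, norm_mul, Complex.norm_I, one_mul, norm_div]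
    gcongr
  have hlim : Tendsto (fun R : ℝ => ‖z‖ / (R - ‖z‖) * ∫ θ in Ioc 0 (2 * Real.pi), B θ) atTop
      (𝓝 (0 * ∫ θ in Ioc 0 (2 * Real.pi), B θ)) :=
    (tendsto_const_nhds.div_atTop (tendsto_atTop_add_const_right _ _ tendsto_id)).mul_const _
  rw [zero_mul] at hlim
  have hle : ‖2 * Real.pi * Complex.I * (F z - F 0)‖ ≤ 0 := by
    refine ge_of_tendsto hlim ?_
    filter_upwards [eventually_gt_atTop 1, eventually_gt_atTop ‖z‖] with R h1 h2
    exact hbound R h1 h2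
  have h3 := norm_le_zero_iff.1 hle
  have h4 : (2 * Real.pi * Complex.I : ℂ) ≠ 0 := Complex.two_pi_I_ne_zero
  exact sub_eq_zero.1 ((mul_eq_zero.1 h3).resolve_left h4)

end BlochSA

theorem corollary2p5 (K : Set ℂ) (hK : IsCompact K) (hKcircle : K ⊆ BlochSA.unitCircle)
    (hKpos : 0 < BlochSA.circleMeasure K) (hSA : BlochSA.HasSAProperty K) :
    BlochSA.IsRemovable 1 K := by
  rintro F ⟨hFK, hFL⟩
  have hF : DifferentiableOn ℂ F BlochSA.unitCircleᶜ := hFK.mono (compl_subset_compl.2 hKcircle)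
  have hKc : (Kᶜ : Set ℂ) =ᵐ[volume] univ := by
    refine ae_eq_univ.2 ?_
    rw [compl_compl]
    exact measure_mono_null hKcircle (Measure.addHaar_sphere volume 0 1)
  have hI : Integrable (deriv F) := by
    have := memLp_one_iff_integrable.1 hFL
    rwa [Measure.restrict_congr_set hKc, Measure.restrict_univ] at this
  have hT := hSA.ae_interiorTrace_eq_exteriorTrace hK.isClosed hFK hF hI
  have hconst : ∀ z : ℂ, ‖z‖ ≠ 1 → F z = F 0 := fun z hz => BlochSA.eq_of_traces_ae_eq hF hI hT hz
  refine ⟨F 0, fun z hz => ?_⟩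
  by_cases hz1 : ‖z‖ = 1
  · have hcl : z ∈ closure BlochSA.disc := by
      rw [closure_ball 0 one_ne_zero, mem_closedBall_zero_iff]
      exact hz1.le
    have hne : (𝓝[BlochSA.disc] z).NeBot := mem_closure_iff_nhdsWithin_neBot.1 hcl
    have hc : Tendsto F (𝓝[BlochSA.disc] z) (𝓝 (F z)) :=
      (hFK.differentiableAt (hK.isClosed.isOpen_compl.mem_nhds hz)).continuousAt.tendsto.mono_left
        nhdsWithin_le_nhds
    refine tendsto_nhds_unique hc (tendsto_const_nhds.congr' ?_)
    filter_upwards [self_mem_nhdsWithin] with w hw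
    exact (hconst w (mem_ball_zero_iff.1 hw).ne).symm
  · exact hconst z hz1
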